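/- Throughout, sequences are complex and indexed by the natural numbers. For $0<p<\infty$ let $\ell_p$ be the set of sequences $u$ with $\sum_n |u_n|^p<\infty$, and let $\ell_{p,\infty}$ (weak $\ell_p$) be the set of sequences $u$ with $\sup_{n\ge 1} n^{1/p}u_n^*<\infty$, where $u_n^*=\inf\{t\ge 0:\ \#\{i: |u_i|>t\}<n\}$ is the decreasing rearrangement of $|u|$. For two sets $A,B$ of sequences, $A\cdot B=\{(u_nw_n)_n:\ u\in A,\ w\in B\}$. For $1<s<\infty$ let $s'=s/(s-1)$ be the conjugate exponent. For $1\le r<\infty$ and $m\in\mathbb N$, let $\mathcal P({}^m\ell_r)$ be the space of bounded $m$-homogeneous polynomials on $\ell_r$, i.e. of all functions $P(x)=L(x,\dots,x)$ with $L$ a bounded $m$-linear form on $\ell_r$. For a finitely supported multi-index $\alpha\in\mathbb N_0^{(\mathbb N)}$ let $c_\alpha(P)=\frac{\partial^\alpha P(0)}{\alpha!}$ be the $\alpha$-th monomial coefficient of $P$, and set $$\operatorname{mon}\mathcal P({}^m\ell_r)=\Big\{z\in\ell_r:\ \sum_{\alpha\in\mathbb N_0^{(\mathbb N)}}|c_\alpha(P)z^\alpha|<\infty\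 \text{ for all }P\in\mathcal P({}^m\ell_r)\Big\}.$$ **Theorem 5.1, parts (3) and (4).** Let $m\ge 2$. (3) If $2\le r<\infty$, then $$\ell_{\frac{2m}{m-1},\infty}\cdot\ell_r\ \subset\ \operatorname{mon}\mathcal P({}^m\ell_r)\ \subset\ \ell_{\left(\frac1r+\frac{m-1}{2m}\right)^{-1},\infty}.$$ (4) If $1<r<2$, then for every $\varepsilon$ with $0<\varepsilon<(mr')'$, $$\ell_{(mr')'-\varepsilon}\ \subset\ \operatorname{mon}\mathcal P({}^m\ell_r)\ \subset\ \ell_{(mr')',\infty}.$$ -/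

import Mathlib

open scoped ENNReal NNReal Pointwise

namespace MonConv

/-- The set of complex sequences in `ℓ_p`, for an exponent `0 < p ≤ ∞`. -/
def seqLp (p : ℝ≥0∞) : Set (ℕ → ℂ) := {u | Memℓp u p}

/-- The decreasing rearrangement `u* = (u*_1 ≥ u*_2 ≥ …)` of a complex sequence, with
`decRearr u n = u*_{n+1} = inf {t ≥ 0 : #{i : |u_i| > t} ≤ n}` (the value is `∞` if there is no
such finite `t`). -/
noncomputable def decRearr (u : ℕ → ℂ) (n : ℕ) : ℝ≥0∞ :=
  sInf {t : ℝ≥0∞ | {i : ℕ | t < ‖u i‖ₑ}.encard ≤ n}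

/-- The weak space (Lorentz, or Marcinkiewicz, sequence space) `ℓ_{p,∞}` for `0 < p < ∞`: all
complex sequences `u` with `sup_{n ≥ 1} n^{1/p} u*_n < ∞`. -/
noncomputable def weakLp (p : ℝ) : Set (ℕ → ℂ) :=
  {u | (⨆ n : ℕ, ((n + 1 : ℕ) : ℝ≥0∞) ^ (1 / p) * decRearr u n) < ∞}

/-- The Banach space `ℓ_r` of complex sequences, `1 ≤ r ≤ ∞`. -/
abbrev Ell (r : ℝ≥0∞) : Type := lp (fun _ : ℕ => ℂ) r

/-- The space `P(^m ℓ_r)` of bounded `m`-homogeneous polynomials on `ℓ_r`: restrictions of bounded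
`m`-linear forms to the diagonal. -/
def homPoly (m : ℕ) (r : ℝ≥0∞) [Fact (1 ≤ r)] : Set (Ell r → ℂ) :=
  {P | ∃ L : ContinuousMultilinearMap ℂ (fun _ : Fin m => Ell r) ℂ, ∀ x, P x = L (fun _ => x)}

/-- For a multi-index `α`, the tuple `j_α = (1, …, 1, 2, …, 2, …)` in which each index `i` is
repeated `α_i` times. -/
noncomputable def indexTuple (α : ℕ →₀ ℕ) : List ℕ := (Finsupp.toMultiset α).sort

/-- The partial derivative `∂^α f (0)`: the Fréchet derivative of order `|α|` of `f` at `0`,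
evaluated at the canonical vectors `e_j`, where each `j` is used `α_j` times. -/
noncomputable def partialDerivZero {r : ℝ≥0∞} [Fact (1 ≤ r)] (f : Ell r → ℂ) (α : ℕ →₀ ℕ) : ℂ :=
  iteratedFDeriv ℂ (indexTuple α).length f 0
    (fun k => lp.single r ((indexTuple α).get k) (1 : ℂ))

/-- The monomial coefficient `c_α(f) = ∂^α f (0) / α!`. -/
noncomputable def monCoeff {r : ℝ≥0∞} [Fact (1 ≤ r)] (f : Ell r → ℂ) (α : ℕ →₀ ℕ) : ℂ :=
  partialDerivZero f α / (α.prod fun _ k => (k.factorial : ℂ))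

/-- The domain of monomial convergence of a set `F` of functions on `ℓ_r`: all `z ∈ ℓ_r` with
`∑_α |c_α(f) z^α| < ∞` for every `f ∈ F`, the sum running over all finitely supported
multi-indices. -/
def mon {r : ℝ≥0∞} [Fact (1 ≤ r)] (F : Set (Ell r → ℂ)) : Set (ℕ → ℂ) :=
  {z | z ∈ seqLp r ∧
    ∀ f ∈ F, Summable fun α : ℕ →₀ ℕ => ‖monCoeff f α * α.prod fun i k => z i ^ k‖}

end MonConv

/-!
Both lower inclusions follow from the absolute convergence of the full coordinate expansion
`∑_i |L(e_{i_1}, …, e_{i_m})| |z_{i_1} ⋯ z_{i_m}|` of a bounded multilinear form, over all tuples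
`i`; by the polarization formula for the derivatives of `x ↦ L(x, …, x)` this dominates the monomial
expansion up to the factor `m!` (`mem_mon_of_summable`). In each case the tuples are split according
to the position `k` of their smallest weight.

* For `1 < r < 2` no loss `ε` is needed: with `q = (m r')'`, smallness of `|z_{i_k}|` allows
  `∏ |z_{i_l}| ≤ |z_{i_k}|^{q/r} ∏_{l ≠ k} |z_{i_l}|^q`, and then the sum over `i_k` is the value of
  a functional on `ℓ_r` at a vector of norm at most `(∑ |z_n|^q)^{1/r}`
  (`prod_le_sum_rpow`, `summable_of_memℓp`).
* For `z = w y` with `w ∈ ℓ_{2m/(m-1),∞}` and `y ∈ ℓ_r`, the factor `y` is absorbed into `L`. The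
  Littlewood–Blei mixed `(ℓ_1, ℓ_2)` inequality, obtained by iterating a Hilbert space valued
  Khintchine inequality (`exists_mixed_norm_le`), bounds `∑_n (∑_j |a_{n,j}|²)^{1/2}`, and
  Cauchy–Schwarz leaves `t (∑_{w_i ≥ t} w_i²)^{(m-1)/2}`, which is bounded uniformly in `t` exactly
  because `w` is in that weak space (`mul_sqrt_sum_sq_pow_le_of_weak`, `summable_of_mul`).

For the upper inclusions, the uniform boundedness principle gives
`∑_α |c_α(L) z^α| ≤ C ‖L‖` for `z` in the domain of convergence (`exists_bound_of_mem_mon`). This is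
tested on forms with `±1` entries whose `m` variables live on disjoint blocks of `n` coordinates on
which `|z| ≥ s`; the left side is then at least `(n s)^m`. A random choice of signs, together with a
net of the Euclidean ball, gives norm `O(√n)` on `ℓ_2` (`exists_sign_tensorForm`). Hölder's inequality
turns this into `O(n^{1/2 + m (1/2 - 1/r)})` for `r ≥ 2`, and interpolation with the trivial bound on
`ℓ_1` by the three lines theorem into `O(n^{1 - 1/r})` for `r ≤ 2`, without a logarithmic factor
(`norm_tensorForm_le_of_two_le`, `norm_tensorForm_le_rpow`). In both cases the resulting decay of `s`
in `n` is the stated weak space (`mem_weakLp_of_mem_mon`).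
-/

open scoped ENNReal NNReal Pointwise

namespace MonConv

/-! ### Monomial coefficients of homogeneous polynomials -/

section Coefficients

variable {r : ℝ≥0∞} [Fact (1 ≤ r)] {m : ℕ}

/-- The tuple `j_α : Fin m → ℕ` listing the indices of a multi-index `α` of degree `m` in increasing
order and with multiplicity (padded with zeros or truncated if the degree of `α` is not `m`). -/
noncomputable def sortedTuple (m : ℕ) (α : ℕ →₀ ℕ) (k : Fin m) : ℕ := (indexTuple α).getD k 0

lemma coe_indexTuple (α : ℕ →₀ ℕ) : ((indexTuple α : List ℕ) : Multiset ℕ) = Finsupp.toMultiset α :=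
  Multiset.sort_eq _ _

lemma sortedTuple_injOn : Set.InjOn (sortedTuple m) {α | (indexTuple α).length = m} := by
  intro α hα β hβ h
  have hl : indexTuple α = indexTuple β := by
    refine List.ext_getElem (hα.trans hβ.symm) fun i h₁ h₂ => ?_
    have := congrFun h ⟨i, hα ▸ h₁⟩
    simpa [sortedTuple, h₁, h₂] using this
  have h2 : Finsupp.toMultiset α = Finsupp.toMultiset β := by
    rw [← coe_indexTuple, hl, coe_indexTuple]
  simpa using congrArg Multiset.toFinsupp h2

lemma prod_sortedTuple {M : Type*} [CommMonoid M] (z : ℕ → M) {α : ℕ →₀ ℕ}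
    (hα : (indexTuple α).length = m) :
    ∏ k, z (sortedTuple m α k) = α.prod fun i k => z i ^ k := by
  subst hα
  calc ∏ k, z (sortedTuple _ α k) = ((indexTuple α).map z).prod := by
        simp [sortedTuple, ← Fin.prod_univ_fun_getElem]
    _ = ((Finsupp.toMultiset α).map z).prod := by
        rw [← coe_indexTuple, Multiset.map_coe, Multiset.prod_coe]
    _ = _ := by
        rw [Finsupp.toMultiset_map, Finsupp.prod_toMultiset,
          Finsupp.prod_mapDomain_index (by simp) (by simp [pow_add])]

/-- Only the derivative of order `m` of an `m`-homogeneous polynomial is nonzero at the origin. -/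
lemma iteratedFDeriv_diagonal_eq_zero {E : Type*} [NormedAddCommGroup E] [NormedSpace ℂ E]
    (L : ContinuousMultilinearMap ℂ (fun _ : Fin m => E) ℂ) {k : ℕ} (hk : k ≠ m) :
    iteratedFDeriv ℂ k (fun x => L fun _ => x) 0 = 0 := by
  let q : FormalMultilinearSeries ℂ E ℂ := fun k => if h : m = k then (h ▸ L) else 0
  have A : HasFiniteFPowerSeriesOnBall (fun x => L fun _ => x) q 0 (m + 1) ⊤ := by
    apply HasFiniteFPowerSeriesOnBall.mk' _ ENNReal.zero_lt_top
    · intro y hy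
      rw [Finset.sum_eq_single_of_mem m]
      · simp [q]
      · simp
      · intro i hi h'i
        simp [q, h'i.symm]
    · intro n hn
      have : m ≠ n := by lia
      simp [q, this]
  ext v
  rw [A.toHasFPowerSeriesOnBall.iteratedFDeriv_eq_sum_of_completeSpace]
  simp [q, hk.symm]

lemma monCoeff_diagonal (L : ContinuousMultilinearMap ℂ (fun _ : Fin m => Ell r) ℂ) {α : ℕ →₀ ℕ}
    (hα : (indexTuple α).length = m) :
    monCoeff (fun x => L fun _ => x) α =
      (∑ σ : Equiv.Perm (Fin m), L fun k => lp.single r (sortedTuple m α (σ k)) (1 : ℂ)) /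
        (α.prod fun _ k => (k.factorial : ℂ)) := by
  subst hα
  rw [monCoeff, partialDerivZero, ContinuousMultilinearMap.iteratedFDeriv_comp_diagonal]
  simp [sortedTuple]

lemma monCoeff_diagonal_of_ne (L : ContinuousMultilinearMap ℂ (fun _ : Fin m => Ell r) ℂ)
    {α : ℕ →₀ ℕ} (hα : (indexTuple α).length ≠ m) :
    monCoeff (fun x => L fun _ => x) α = 0 := by
  rw [monCoeff, partialDerivZero, iteratedFDeriv_diagonal_eq_zero L hα]
  simp

lemma one_le_norm_prod_factorial (α : ℕ →₀ ℕ) :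
    1 ≤ ‖α.prod fun _ k => (k.factorial : ℂ)‖ := by
  rw [Finsupp.prod, norm_prod]
  refine Finset.one_le_prod fun i _ => ?_
  rw [Complex.norm_natCast]
  exact_mod_cast Nat.one_le_iff_ne_zero.2 (Nat.factorial_ne_zero _)

/-- A point of `ℓ_r` lies in the domain of monomial convergence as soon as the full (unordered)
coordinate expansion of every bounded multilinear form converges absolutely there. -/
lemma mem_mon_of_summable {z : ℕ → ℂ} (hz : z ∈ seqLp r)
    (h : ∀ L : ContinuousMultilinearMap ℂ (fun _ : Fin m => Ell r) ℂ,
      Summable fun i : Fin m → ℕ => ‖L fun k => lp.single r (i k) (1 : ℂ)‖ * ∏ k, ‖z (i k)‖) :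
    z ∈ mon (homPoly m r) := by
  refine ⟨hz, ?_⟩
  rintro f ⟨L, hL⟩
  obtain rfl : f = fun x => L fun _ => x := funext hL
  set g : (Fin m → ℕ) → ℝ := fun i =>
    ‖L fun k => lp.single r (i k) (1 : ℂ)‖ * ∏ k, ‖z (i k)‖ with hg
  set D : Set (ℕ →₀ ℕ) := {α | (indexTuple α).length = m} with hD
  -- For fixed `σ`, distinct multi-indices give distinct tuples `j_α ∘ σ`.
  have hS : ∀ σ : Equiv.Perm (Fin m),
      Summable (D.indicator fun α => g (sortedTuple m α ∘ σ)) := by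
    intro σ
    rw [← summable_subtype_iff_indicator]
    refine (h L).comp_injective (i := fun α : D => sortedTuple m α ∘ σ) fun α β hαβ => ?_
    exact Subtype.ext (sortedTuple_injOn α.2 β.2 (σ.surjective.injective_comp_right hαβ))
  refine Summable.of_nonneg_of_le (fun _ => norm_nonneg _) (fun α => ?_)
    (summable_sum fun σ (_ : σ ∈ Finset.univ) => hS σ)
  by_cases hα : (indexTuple α).length = m
  · simp only [Set.indicator_of_mem (show α ∈ D from hα)]
    rw [monCoeff_diagonal L hα, norm_mul, norm_div]
    calc _ ≤ ‖∑ σ : Equiv.Perm (Fin m), L fun k => lp.single r (sortedTuple m α (σ k)) (1 : ℂ)‖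
          * ‖α.prod fun i k => z i ^ k‖ := by
          gcongr
          exact div_le_self (norm_nonneg _) (one_le_norm_prod_factorial α)
      _ ≤ (∑ σ : Equiv.Perm (Fin m), ‖L fun k => lp.single r (sortedTuple m α (σ k)) (1 : ℂ)‖)
          * ‖α.prod fun i k => z i ^ k‖ := by
          gcongr
          exact norm_sum_le _ _
      _ = _ := by
          rw [Finset.sum_mul]
          refine Finset.sum_congr rfl fun σ _ => ?_
          simp only [hg, Function.comp]
          rw [← prod_sortedTuple z hα, norm_prod,
            Equiv.prod_comp σ fun k => ‖z (sortedTuple m α k)‖]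
  · simp [Set.indicator_of_notMem (show α ∉ D from hα), monCoeff_diagonal_of_ne L hα]

/-- The monomial coefficient as a bounded functional of the multilinear form. -/
lemma exists_clm_monCoeff (α : ℕ →₀ ℕ) :
    ∃ T : ContinuousMultilinearMap ℂ (fun _ : Fin m => Ell r) ℂ →L[ℂ] ℂ,
      ∀ L, T L = monCoeff (fun x => L fun _ => x) α := by
  by_cases hα : (indexTuple α).length = m
  · refine ⟨(α.prod fun _ k => (k.factorial : ℂ))⁻¹ • ∑ σ : Equiv.Perm (Fin m),
      ContinuousMultilinearMap.apply ℂ (fun _ : Fin m => Ell r) ℂ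
        (fun k => lp.single r (sortedTuple m α (σ k)) (1 : ℂ)), fun L => ?_⟩
    rw [monCoeff_diagonal L hα]
    simp [div_eq_inv_mul]
  · exact ⟨0, fun L => by simp [monCoeff_diagonal_of_ne L hα]⟩

/-- If all monomial expansions converge absolutely at `z`, the uniform boundedness principle bounds
their sums by a multiple of the norm of the multilinear form. -/
lemma exists_bound_of_mem_mon {z : ℕ → ℂ} (hz : z ∈ mon (homPoly m r)) :
    ∃ C : ℝ, ∀ (L : ContinuousMultilinearMap ℂ (fun _ : Fin m => Ell r) ℂ)
      (F : Finset (ℕ →₀ ℕ)),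
      ∑ α ∈ F, ‖monCoeff (fun x => L fun _ => x) α * α.prod fun i k => z i ^ k‖ ≤ C * ‖L‖ := by
  choose T hT using fun α : ℕ →₀ ℕ => exists_clm_monCoeff (r := r) (m := m) α
  let g : Finset (ℕ →₀ ℕ) × ((ℕ →₀ ℕ) → Metric.closedBall (0 : ℂ) 1) →
      ContinuousMultilinearMap ℂ (fun _ : Fin m => Ell r) ℂ →L[ℂ] ℂ :=
    fun p => ∑ α ∈ p.1, ((p.2 α : ℂ) * α.prod fun i k => z i ^ k) • T α
  obtain ⟨C, hC⟩ := banach_steinhaus (g := g) fun L => by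
    refine ⟨∑' α, ‖monCoeff (fun x => L fun _ => x) α * α.prod fun i k => z i ^ k‖, ?_⟩
    rintro ⟨F, θ⟩
    have hs := hz.2 (fun x => L fun _ => x) ⟨L, fun _ => rfl⟩
    refine le_trans ?_ (hs.sum_le_tsum F fun _ _ => norm_nonneg _)
    simp only [g, sum_apply, smul_apply, hT]
    refine (norm_sum_le _ _).trans (Finset.sum_le_sum fun α _ => ?_)
    have h1 : ‖(θ α : ℂ)‖ ≤ 1 := mem_closedBall_zero_iff.1 (θ α).2
    rw [smul_eq_mul, norm_mul, norm_mul, norm_mul, mul_comm (‖monCoeff _ _‖)]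
    gcongr
    exact mul_le_of_le_one_left (norm_nonneg _) h1
  refine ⟨C, fun L F => ?_⟩
  set c : (ℕ →₀ ℕ) → ℂ := fun α => monCoeff (fun x => L fun _ => x) α * α.prod fun i k => z i ^ k
  have hθ : ∀ w : ℂ, ∃ t ∈ Metric.closedBall (0 : ℂ) 1, t * w = (‖w‖ : ℂ) := by
    intro w
    by_cases hw : w = 0
    · exact ⟨0, by simp, by simp [hw]⟩
    · have : (‖w‖ : ℂ) ≠ 0 := by simpa using hw
      exact ⟨‖w‖ / w, by simp [hw], by field_simp⟩
  choose t ht htw using hθ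
  have h := (g (F, fun α => ⟨t (c α), ht _⟩)).le_of_opNorm_le (hC _) L
  have hval : g (F, fun α => ⟨t (c α), ht _⟩) L = ((∑ α ∈ F, ‖c α‖ : ℝ) : ℂ) := by
    simp only [g, sum_apply, smul_apply, hT,
      Complex.ofReal_sum]
    refine Finset.sum_congr rfl fun α _ => ?_
    rw [← htw (c α), smul_eq_mul]
    ring
  rw [hval, Complex.norm_real, Real.norm_of_nonneg (by positivity)] at h
  exact h

/-- The multi-index of the monomial `x_{j_1} ⋯ x_{j_m}`. -/
noncomputable def tupleIndex (j : Fin m → ℕ) : ℕ →₀ ℕ := ∑ k, Finsupp.single (j k) 1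

lemma toMultiset_tupleIndex (j : Fin m → ℕ) :
    Finsupp.toMultiset (tupleIndex j) = Finset.univ.val.map j := by
  rw [tupleIndex, map_sum]
  simp only [Finsupp.toMultiset_single, one_smul]
  rw [← Multiset.bind_singleton]
  rfl

lemma length_indexTuple_tupleIndex (j : Fin m → ℕ) : (indexTuple (tupleIndex j)).length = m := by
  rw [indexTuple, Multiset.length_sort, toMultiset_tupleIndex]
  simp

lemma exists_perm_sortedTuple {j : Fin m → ℕ} (hj : Function.Injective j) :
    ∃ σ : Equiv.Perm (Fin m), ∀ k, sortedTuple m (tupleIndex j) k = j (σ k) := by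
  have hlen := length_indexTuple_tupleIndex j
  have hmem : ∀ k, ∃ l, j l = sortedTuple m (tupleIndex j) k := by
    intro k
    have hk : (k : ℕ) < (indexTuple (tupleIndex j)).length := hlen.symm ▸ k.2
    have : sortedTuple m (tupleIndex j) k ∈ ((indexTuple (tupleIndex j) : List ℕ) : Multiset ℕ) := by
      simp [sortedTuple, hk]
    rw [coe_indexTuple, toMultiset_tupleIndex] at this
    simpa using this
  choose σ hσ using hmem
  have hnd : (indexTuple (tupleIndex j)).Nodup := by
    rw [← Multiset.coe_nodup, coe_indexTuple, toMultiset_tupleIndex]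
    exact Fintype.nodup_map_univ_iff_injective.2 hj
  have hinj : Function.Injective σ := by
    intro a b hab
    have h : sortedTuple m (tupleIndex j) a = sortedTuple m (tupleIndex j) b := by
      rw [← hσ, ← hσ, hab]
    have ha : (a : ℕ) < (indexTuple (tupleIndex j)).length := hlen.symm ▸ a.2
    have hb : (b : ℕ) < (indexTuple (tupleIndex j)).length := hlen.symm ▸ b.2
    simp only [sortedTuple, List.getD_eq_getElem _ _ ha, List.getD_eq_getElem _ _ hb] at h
    exact Fin.ext ((hnd.getElem_inj_iff).1 h)
  exact ⟨Equiv.ofBijective σ hinj.bijective_of_finite, fun k => (hσ k).symm⟩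

lemma prod_tupleIndex {M : Type*} [CommMonoid M] (z : ℕ → M) (j : Fin m → ℕ) :
    (tupleIndex j).prod (fun i k => z i ^ k) = ∏ k, z (j k) := by
  classical
  rw [tupleIndex, ← Finsupp.prod_finsetSum_index (by simp) (by simp [pow_add])]
  simp

/-- A square-free monomial coefficient is the sum of the entries of the form over all orderings of
the indices. -/
lemma monCoeff_tupleIndex (L : ContinuousMultilinearMap ℂ (fun _ : Fin m => Ell r) ℂ)
    {j : Fin m → ℕ} (hj : Function.Injective j) :
    monCoeff (fun x => L fun _ => x) (tupleIndex j) =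
      ∑ σ : Equiv.Perm (Fin m), L fun k => lp.single r (j (σ k)) (1 : ℂ) := by
  obtain ⟨τ, hτ⟩ := exists_perm_sortedTuple hj
  have hfac : (tupleIndex j).prod (fun _ k => (k.factorial : ℂ)) = 1 := by
    refine Finset.prod_eq_one fun i _ => ?_
    have : tupleIndex j i ≤ 1 := by
      rw [← Finsupp.count_toMultiset, toMultiset_tupleIndex]
      exact Multiset.nodup_iff_count_le_one.1 (Fintype.nodup_map_univ_iff_injective.2 hj) i
    interval_cases tupleIndex j i <;> simp
  rw [monCoeff_diagonal L (length_indexTuple_tupleIndex j), hfac, div_one]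
  simp only [hτ]
  exact Fintype.sum_equiv (Equiv.mulLeft τ) _ _ fun σ => rfl

end Coefficients

/-! ### Weak sequence spaces -/

section WeakSpaces

/-- Membership in `ℓ_{p,∞}` through the sizes of the sets on which `|u|` is at least `s`. -/
lemma mem_weakLp_iff {p : ℝ} (hp : 0 < p) {u : ℕ → ℂ} :
    u ∈ weakLp p ↔ ∃ D : ℝ, ∀ (S : Finset ℕ) (s : ℝ), 0 ≤ s → (∀ i ∈ S, s ≤ ‖u i‖) →
      (S.card : ℝ) ^ (1 / p) * s ≤ D := by
  have hp' : 0 < 1 / p := by positivity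
  constructor
  · intro hu
    set M : ℝ≥0∞ := ⨆ n : ℕ, ((n + 1 : ℕ) : ℝ≥0∞) ^ (1 / p) * decRearr u n with hM
    have hMfin : M ≠ ∞ := ne_of_lt hu
    refine ⟨M.toReal, fun S s hs hS => ?_⟩
    rcases hcard : S.card with _ | n
    · rw [Nat.cast_zero, Real.zero_rpow hp'.ne', zero_mul]
      positivity
    have h1 : ENNReal.ofReal s ≤ decRearr u n := by
      refine le_sInf fun t ht => ?_
      by_contra! hlt
      have hsub : (S : Set ℕ) ⊆ {i : ℕ | t < ‖u i‖ₑ} := fun i hi => by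
        refine hlt.trans_le ?_
        rw [← ofReal_norm]
        exact ENNReal.ofReal_le_ofReal (hS i hi)
      have := (Set.encard_le_encard hsub).trans ht
      rw [Set.encard_coe_eq_coe_finsetCard, hcard] at this
      have : n + 1 ≤ n := by exact_mod_cast this
      lia
    have h2 : ((n + 1 : ℕ) : ℝ≥0∞) ^ (1 / p) * ENNReal.ofReal s ≤ M :=
      (mul_le_mul_right h1 _).trans
        (le_iSup (fun n : ℕ => ((n + 1 : ℕ) : ℝ≥0∞) ^ (1 / p) * decRearr u n) n)
    have h3 := ENNReal.toReal_mono hMfin h2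
    rwa [ENNReal.toReal_mul, ← ENNReal.toReal_rpow, ENNReal.toReal_natCast,
      ENNReal.toReal_ofReal hs] at h3
  · rintro ⟨D, hD⟩
    refine lt_of_le_of_lt (iSup_le fun n => ?_) (ENNReal.ofReal_lt_top (r := D))
    have hn : (0 : ℝ) < ((n + 1 : ℕ) : ℝ) ^ (1 / p) := by positivity
    have h1 : decRearr u n ≤ ENNReal.ofReal (D / ((n + 1 : ℕ) : ℝ) ^ (1 / p)) := by
      refine sInf_le ?_
      by_contra hlt
      have hlt' : ((n + 1 : ℕ) : ℕ∞) ≤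
          {i : ℕ | ENNReal.ofReal (D / ((n + 1 : ℕ) : ℝ) ^ (1 / p)) < ‖u i‖ₑ}.encard := by
        have := Order.add_one_le_of_lt (not_le.1 (show ¬ _ ≤ (n : ℕ∞) from hlt))
        exact_mod_cast this
      obtain ⟨T, hTsub, hT⟩ := Set.exists_subset_encard_eq hlt'
      have hTfin : T.Finite := Set.finite_of_encard_eq_coe hT
      obtain ⟨S, rfl⟩ := hTfin.exists_finset_coe
      rw [Set.encard_coe_eq_coe_finsetCard] at hT
      have hcard : S.card = n + 1 := by exact_mod_cast hT
      have hne : S.Nonempty := Finset.card_pos.1 (by lia)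
      obtain ⟨i₀, hi₀, hmin⟩ := S.exists_min_image (fun i => ‖u i‖) hne
      have h := hD S ‖u i₀‖ (norm_nonneg _) hmin
      have h' : ENNReal.ofReal (D / ((n + 1 : ℕ) : ℝ) ^ (1 / p)) < ‖u i₀‖ₑ := hTsub hi₀
      rw [← ofReal_norm] at h'
      have h'' := (ENNReal.ofReal_lt_ofReal_iff'.1 h').1
      rw [div_lt_iff₀ hn, mul_comm, ← hcard] at h''
      exact absurd h (not_le.2 h'')
    calc _ ≤ ((n + 1 : ℕ) : ℝ≥0∞) ^ (1 / p)
          * ENNReal.ofReal (D / ((n + 1 : ℕ) : ℝ) ^ (1 / p)) := by gcongr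
      _ = ENNReal.ofReal D := by
        rw [← ENNReal.ofReal_natCast, ENNReal.ofReal_rpow_of_pos (by positivity),
          ← ENNReal.ofReal_mul hn.le, mul_div_cancel₀ _ hn.ne']

end WeakSpaces

/-! ### Separating one variable of a multilinear form -/

section Slots

lemma lpSingle_insertNth {r : ℝ≥0∞} {d N : ℕ} (k : Fin (d + 1)) (n : Fin N) (j : Fin d → Fin N) :
    (fun l => lp.single r ((k.insertNth n j : Fin (d + 1) → Fin N) l : ℕ) (1 : ℂ) :
      Fin (d + 1) → Ell r)
      = k.insertNth (lp.single r (n : ℕ) (1 : ℂ)) fun l => lp.single r (j l : ℕ) (1 : ℂ) := by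
  ext1 l
  refine Fin.succAboveCases k ?_ (fun l => ?_) l <;> simp

variable {r : ℝ≥0∞} [Fact (1 ≤ r)]

lemma toReal_pos_of_one_le (hr : r ≠ ∞) : 0 < r.toReal :=
  ENNReal.toReal_pos (zero_lt_one.trans_le (Fact.out : 1 ≤ r)).ne' hr

lemma norm_sum_single_eq (hr : r ≠ ∞) (s : Finset ℕ) (f : ℕ → ℂ) :
    ‖(∑ n ∈ s, lp.single r n (f n) : Ell r)‖ = (∑ n ∈ s, ‖f n‖ ^ r.toReal) ^ (1 / r.toReal) := by
  have hr0 := toReal_pos_of_one_le hr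
  have h := lp.norm_sum_single (E := fun _ : ℕ => ℂ) hr0 f s
  rw [← h, one_div, Real.rpow_rpow_inv (norm_nonneg _) hr0.ne']

/-- Rotating the coefficients of `∑ c_n e_n` turns a bound for a functional on `ℓ_r` into a bound
for the weighted sum of the moduli of its coordinates. -/
lemma sum_norm_single_mul_le (hr : r ≠ ∞) (φ : Ell r →ₗ[ℂ] ℂ) {B : ℝ} (hB : 0 ≤ B)
    (hφ : ∀ x, ‖φ x‖ ≤ B * ‖x‖) (s : Finset ℕ) {c : ℕ → ℝ} (hc : ∀ n, 0 ≤ c n) :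
    ∑ n ∈ s, ‖φ (lp.single r n (1 : ℂ))‖ * c n
      ≤ B * (∑ n ∈ s, c n ^ r.toReal) ^ (1 / r.toReal) := by
  have hr0 := toReal_pos_of_one_le hr
  have hθ : ∀ n, ∃ t : ℂ, ‖t‖ ≤ 1 ∧ t * φ (lp.single r n (1 : ℂ))
      = (‖φ (lp.single r n (1 : ℂ))‖ : ℂ) := by
    intro n
    by_cases hw : φ (lp.single r n (1 : ℂ)) = 0
    · exact ⟨0, by simp, by simp [hw]⟩
    · have : (‖φ (lp.single r n (1 : ℂ))‖ : ℂ) ≠ 0 := by simpa using hw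
      exact ⟨‖φ (lp.single r n (1 : ℂ))‖ / φ (lp.single r n (1 : ℂ)), by simp [hw], by field_simp⟩
  choose t ht htφ using hθ
  set x : Ell r := ∑ n ∈ s, lp.single r n (t n * c n) with hx
  have hφx : φ x = ((∑ n ∈ s, ‖φ (lp.single r n (1 : ℂ))‖ * c n : ℝ) : ℂ) := by
    rw [hx, map_sum, Complex.ofReal_sum]
    refine Finset.sum_congr rfl fun n _ => ?_
    have : lp.single (E := fun _ : ℕ => ℂ) r n (t n * c n)
        = (t n * c n) • lp.single (E := fun _ : ℕ => ℂ) r n (1 : ℂ) := by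
      rw [← lp.single_smul]; simp
    rw [this, map_smul, smul_eq_mul, Complex.ofReal_mul, ← htφ]
    ring
  have hxn : ‖x‖ ≤ (∑ n ∈ s, c n ^ r.toReal) ^ (1 / r.toReal) := by
    rw [hx, norm_sum_single_eq hr]
    gcongr with n
    rw [norm_mul, Complex.norm_real, Real.norm_of_nonneg (hc n)]
    exact mul_le_of_le_one_left (hc n) (ht n)
  have := hφ x
  rw [hφx, Complex.norm_real, Real.norm_of_nonneg
    (Finset.sum_nonneg fun n _ => mul_nonneg (norm_nonneg _) (hc n))] at this
  exact this.trans (mul_le_mul_of_nonneg_left hxn hB)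

/-- The functional `x ↦ L(u_1, …, x, …, u_d)` with `x` in the `k`-th variable. -/
noncomputable def slotFunctional {d : ℕ}
    (L : ContinuousMultilinearMap ℂ (fun _ : Fin (d + 1) => Ell r) ℂ) (k : Fin (d + 1))
    (u : Fin d → Ell r) : Ell r →ₗ[ℂ] ℂ where
  toFun x := L (k.insertNth x u)
  map_add' a b := congrArg (fun T => T u) ((L.toMultilinearMap.curryMid k).map_add a b)
  map_smul' a b := congrArg (fun T => T u) ((L.toMultilinearMap.curryMid k).map_smul a b)

lemma slotFunctional_apply {d : ℕ}
    (L : ContinuousMultilinearMap ℂ (fun _ : Fin (d + 1) => Ell r) ℂ) (k : Fin (d + 1))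
    (u : Fin d → Ell r) (x : Ell r) : slotFunctional L k u x = L (k.insertNth x u) := rfl

lemma norm_slotFunctional_le {d : ℕ}
    (L : ContinuousMultilinearMap ℂ (fun _ : Fin (d + 1) => Ell r) ℂ) (k : Fin (d + 1))
    {u : Fin d → Ell r} {B : ℝ} (hu : ∀ l, ‖u l‖ ≤ B) (x : Ell r) :
    ‖slotFunctional L k u x‖ ≤ ‖L‖ * B ^ d * ‖x‖ := by
  refine (L.le_opNorm _).trans ?_
  rw [Fin.prod_univ_succAbove _ k]
  simp only [Fin.insertNth_apply_same, Fin.insertNth_apply_succAbove]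
  have : ∏ l, ‖u l‖ ≤ B ^ d := by
    refine (Finset.prod_le_prod (fun l _ => norm_nonneg _) fun l _ => hu l).trans ?_
    simp
  calc _ ≤ ‖L‖ * (‖x‖ * B ^ d) := by gcongr
    _ = _ := by ring

/-- Summability over all tuples follows from uniform bounds over the cubes `{0, …, N-1}^m`. -/
lemma summable_of_sum_cube_le {m : ℕ} {g : (Fin m → ℕ) → ℝ} (hg : ∀ i, 0 ≤ g i) {C : ℝ}
    (h : ∀ N : ℕ, ∑ i : Fin m → Fin N, g (fun k => i k) ≤ C) : Summable g := by
  refine summable_of_sum_le hg (c := C) fun u => ?_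
  obtain ⟨N, hN⟩ : ∃ N : ℕ, ∀ i ∈ u, ∀ k, i k < N := by
    refine ⟨u.sup (fun i => Finset.univ.sup i) + 1, fun i hi k => Nat.lt_succ_of_le ?_⟩
    exact (Finset.le_sup (f := i) (Finset.mem_univ k)).trans
      (Finset.le_sup (f := fun i : Fin m → ℕ => Finset.univ.sup i) hi)
  have hinj : Function.Injective fun (i : Fin m → Fin N) (k : Fin m) => (i k : ℕ) :=
    fun i j hij => funext fun k => Fin.ext (congrFun hij k)
  calc ∑ i ∈ u, g i ≤ ∑ i ∈ Finset.univ.map ⟨_, hinj⟩, g i := by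
        refine Finset.sum_le_sum_of_subset_of_nonneg (fun i hi => ?_) fun i _ _ => hg i
        exact Finset.mem_map.2 ⟨fun k => ⟨i k, hN i hi k⟩, Finset.mem_univ _, rfl⟩
    _ ≤ C := by rw [Finset.sum_map]; exact h N

/-- Splitting off the `k`-th coordinate of a sum over tuples. -/
lemma sum_tuple_eq_sum_insertNth {ι M : Type*} [Fintype ι] [AddCommMonoid M] {d : ℕ}
    (k : Fin (d + 1)) (f : (Fin (d + 1) → ι) → M) :
    ∑ i, f i = ∑ n, ∑ j : Fin d → ι, f (k.insertNth n j) := by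
  rw [← (Fin.insertNthEquiv (fun _ => ι) k).sum_comp, Fintype.sum_prod_type]
  rfl

end Slots

/-! ### Convergence at points of `ℓ_q` -/

section SmallExponents

/-- If `k` is a position at which `w` is smallest, part of the factor `w_{i_k}` can be distributed
over the other factors; summing over the possible positions removes the case distinction. -/
lemma prod_le_sum_rpow {ι : Type*} {d : ℕ} {w : ι → ℝ} (hw : ∀ i, 0 ≤ w i) {q s : ℝ} (hq : 1 ≤ q)
    (hs : 0 ≤ s) (h : s + d * (q - 1) = 1) (i : Fin (d + 1) → ι) :
    ∏ k, w (i k) ≤ ∑ k, w (i k) ^ s * ∏ l, w (i (k.succAbove l)) ^ q := by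
  obtain ⟨k, hk⟩ := Finite.exists_min fun k => w (i k)
  refine le_trans ?_ (Finset.single_le_sum (f := fun k => w (i k) ^ s *
    ∏ l, w (i (k.succAbove l)) ^ q) (fun k _ => mul_nonneg (Real.rpow_nonneg (hw _) _)
      (Finset.prod_nonneg fun _ _ => Real.rpow_nonneg (hw _) _)) (Finset.mem_univ k))
  have hq' : 0 ≤ q - 1 := by linarith
  rw [Fin.prod_univ_succAbove _ k]
  calc w (i k) * ∏ l, w (i (k.succAbove l))
      = w (i k) ^ s * ((∏ _l : Fin d, w (i k) ^ (q - 1)) * ∏ l, w (i (k.succAbove l))) := by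
        rw [← mul_assoc]
        congr 1
        conv_lhs => rw [← Real.rpow_one (w (i k)), ← h,
          Real.rpow_add_of_nonneg (hw _) hs (by positivity), mul_comm (d : ℝ),
          Real.rpow_mul_natCast (hw _)]
        simp
    _ ≤ w (i k) ^ s * ((∏ l, w (i (k.succAbove l)) ^ (q - 1)) * ∏ l, w (i (k.succAbove l))) := by
        have := hw
        gcongr with l
        · exact Real.rpow_nonneg (hw _) _
        · exact Finset.prod_nonneg fun _ _ => hw _
        · exact fun _ _ => Real.rpow_nonneg (hw _) _
        · exact hw _
        · exact hk _
    _ = _ := by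
        rw [← Finset.prod_mul_distrib]
        congr 1
        refine Finset.prod_congr rfl fun l _ => ?_
        conv_rhs => rw [← sub_add_cancel q 1, Real.rpow_add_of_nonneg (hw _) hq' zero_le_one,
          Real.rpow_one]

variable {r : ℝ≥0∞} [Fact (1 ≤ r)]

lemma norm_single_one (n : ℕ) : ‖(lp.single r n (1 : ℂ) : Ell r)‖ = 1 := by
  rw [lp.norm_single (zero_lt_one.trans_le (Fact.out : 1 ≤ r)), norm_one]

/-- Absolute convergence at points of `ℓ_q` for `q / r + (m - 1) (q - 1) = 1`. -/
lemma summable_of_memℓp (hr : r ≠ ∞) {d : ℕ} {q : ℝ} (hq : 1 ≤ q)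
    (h : q / r.toReal + d * (q - 1) = 1) {z : ℕ → ℂ} (hz : Summable fun n => ‖z n‖ ^ q)
    (L : ContinuousMultilinearMap ℂ (fun _ : Fin (d + 1) => Ell r) ℂ) :
    Summable fun i : Fin (d + 1) → ℕ =>
      ‖L fun k => lp.single r (i k) (1 : ℂ)‖ * ∏ k, ‖z (i k)‖ := by
  have hr0 := toReal_pos_of_one_le hr
  set W : ℝ := ∑' n, ‖z n‖ ^ q with hW
  refine summable_of_sum_cube_le (fun i => by positivity)
    (C := ∑ _k : Fin (d + 1), W ^ d * (‖L‖ * W ^ (1 / r.toReal))) fun N => ?_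
  have hWN : ∑ n : Fin N, ‖z n‖ ^ q ≤ W := by
    rw [Fin.sum_univ_eq_sum_range fun n => ‖z n‖ ^ q]
    exact hz.sum_le_tsum _ fun _ _ => by positivity
  have hslot : ∀ (k : Fin (d + 1)) (j : Fin d → Fin N),
      ∑ n : Fin N, ‖L fun l => lp.single r ((k.insertNth n j : Fin (d + 1) → Fin N) l : ℕ) (1 : ℂ)‖
        * ‖z n‖ ^ (q / r.toReal) ≤ ‖L‖ * W ^ (1 / r.toReal) := by
    intro k j
    set φ := slotFunctional L k fun l => lp.single r (j l : ℕ) (1 : ℂ) with hφ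
    have hb := sum_norm_single_mul_le hr φ (by positivity)
      (norm_slotFunctional_le L k fun l => (norm_single_one (r := r) (j l : ℕ)).le)
      (Finset.range N) (c := fun n => ‖z n‖ ^ (q / r.toReal)) fun n => by positivity
    rw [one_pow, mul_one, ← Fin.sum_univ_eq_sum_range fun n =>
      ‖φ (lp.single r n (1 : ℂ))‖ * ‖z n‖ ^ (q / r.toReal)] at hb
    simp only [lpSingle_insertNth, ← slotFunctional_apply]
    refine hb.trans ?_
    gcongr
    rw [← Fin.sum_univ_eq_sum_range fun n => (‖z n‖ ^ (q / r.toReal)) ^ r.toReal]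
    refine le_trans (le_of_eq (Finset.sum_congr rfl fun n _ => ?_)) hWN
    rw [← Real.rpow_mul (norm_nonneg _), div_mul_cancel₀ _ hr0.ne']
  calc ∑ i : Fin (d + 1) → Fin N, ‖L fun k => lp.single r (i k : ℕ) (1 : ℂ)‖ * ∏ k, ‖z (i k)‖
      ≤ ∑ i : Fin (d + 1) → Fin N, ‖L fun k => lp.single r (i k : ℕ) (1 : ℂ)‖ *
        ∑ k, ‖z (i k)‖ ^ (q / r.toReal) * ∏ l, ‖z (i (k.succAbove l))‖ ^ q := by
        gcongr with i
        exact prod_le_sum_rpow (w := fun n : Fin N => ‖z n‖) (fun _ => norm_nonneg _) hq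
          (by positivity) h i
    _ = ∑ k, ∑ i : Fin (d + 1) → Fin N, ‖L fun k => lp.single r (i k : ℕ) (1 : ℂ)‖ *
        (‖z (i k)‖ ^ (q / r.toReal) * ∏ l, ‖z (i (k.succAbove l))‖ ^ q) := by
        rw [Finset.sum_comm]
        simp only [Finset.mul_sum]
    _ ≤ _ := by
        refine Finset.sum_le_sum fun k _ => ?_
        rw [sum_tuple_eq_sum_insertNth k, Finset.sum_comm]
        calc _ = ∑ j : Fin d → Fin N, (∏ l, ‖z (j l)‖ ^ q) * ∑ n : Fin N,
              ‖L fun l => lp.single r ((k.insertNth n j : Fin (d + 1) → Fin N) l : ℕ) (1 : ℂ)‖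
                * ‖z n‖ ^ (q / r.toReal) := by
              refine Finset.sum_congr rfl fun j _ => ?_
              rw [Finset.mul_sum]
              refine Finset.sum_congr rfl fun n _ => ?_
              simp only [Fin.insertNth_apply_same, Fin.insertNth_apply_succAbove]
              ring
          _ ≤ ∑ j : Fin d → Fin N, (∏ l, ‖z (j l)‖ ^ q) * (‖L‖ * W ^ (1 / r.toReal)) := by
              gcongr with j
              exact hslot k j
          _ = (∑ n : Fin N, ‖z n‖ ^ q) ^ d * (‖L‖ * W ^ (1 / r.toReal)) := by
              rw [← Finset.sum_mul, Fintype.sum_pow]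
          _ ≤ _ := by
              have : 0 ≤ W := tsum_nonneg fun n => by positivity
              gcongr

end SmallExponents

/-! ### Khintchine's inequality and mixed norms -/

section Khintchine

variable {ι H : Type*} [Fintype ι] [DecidableEq ι] [NormedAddCommGroup H] [InnerProductSpace ℝ H]

/-- The signed sum `∑_{i ∈ s} ε_i v_i`; signs are units of `ℤ`. -/
def signSum (v : ι → H) (s : Finset ι) (ε : ι → ℤˣ) : H := ∑ i ∈ s, ((ε i : ℤ) : ℝ) • v i

lemma abs_sign (e : ℤˣ) : |((e : ℤ) : ℝ)| = 1 := by
  rcases Int.units_eq_one_or e with rfl | rfl <;> simp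

/-- Flipping the sign `ε_a` does not change the average over all signs. -/
lemma sum_signSum_insert (v : ι → H) {s : Finset ι} {a : ι} (ha : a ∉ s) (f : H → ℝ) :
    ∑ ε : ι → ℤˣ, f (signSum v (insert a s) ε) =
      ∑ ε : ι → ℤˣ, (f (signSum v s ε + ((ε a : ℤ) : ℝ) • v a)
        + f (signSum v s ε - ((ε a : ℤ) : ℝ) • v a)) / 2 := by
  have h1 : ∀ ε : ι → ℤˣ, signSum v (insert a s) ε = signSum v s ε + ((ε a : ℤ) : ℝ) • v a := by
    intro ε
    rw [signSum, Finset.sum_insert ha, add_comm, signSum]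
  have h2 : ∑ ε : ι → ℤˣ, f (signSum v s ε - ((ε a : ℤ) : ℝ) • v a)
      = ∑ ε : ι → ℤˣ, f (signSum v s ε + ((ε a : ℤ) : ℝ) • v a) := by
    refine Fintype.sum_equiv (Equiv.mulRight (Pi.mulSingle a (-1) : ι → ℤˣ)) _ _ fun ε => ?_
    have h3 : signSum v s (ε * Pi.mulSingle a (-1)) = signSum v s ε := by
      refine Finset.sum_congr rfl fun i hi => ?_
      have : i ≠ a := fun h => ha (h ▸ hi)
      simp [this]
    simp [h3, sub_eq_add_neg]
  rw [← Finset.sum_div, Finset.sum_add_distrib, h2]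
  simp only [h1]
  ring

lemma sum_norm_signSum_sq (v : ι → H) (s : Finset ι) :
    ∑ ε : ι → ℤˣ, ‖signSum v s ε‖ ^ 2 = Fintype.card (ι → ℤˣ) * ∑ i ∈ s, ‖v i‖ ^ 2 := by
  induction s using Finset.induction_on with
  | empty => simp [signSum]
  | insert a s ha ih =>
    rw [sum_signSum_insert v ha fun x => ‖x‖ ^ 2, Finset.sum_insert ha, mul_add, ← ih]
    rw [show (Fintype.card (ι → ℤˣ) : ℝ) * ‖v a‖ ^ 2 = ∑ _ε : ι → ℤˣ, ‖v a‖ ^ 2 by simp,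
      ← Finset.sum_add_distrib]
    refine Finset.sum_congr rfl fun ε _ => ?_
    rw [norm_add_sq_real, norm_sub_sq_real, norm_smul, Real.norm_eq_abs, abs_sign]
    ring

lemma sum_norm_signSum_pow_four (v : ι → H) (s : Finset ι) :
    ∑ ε : ι → ℤˣ, ‖signSum v s ε‖ ^ 4
      ≤ 3 * Fintype.card (ι → ℤˣ) * (∑ i ∈ s, ‖v i‖ ^ 2) ^ 2 := by
  induction s using Finset.induction_on with
  | empty => simp [signSum]
  | insert a s ha ih =>
    have h2 := sum_norm_signSum_sq v s
    rw [sum_signSum_insert v ha fun x => ‖x‖ ^ 4, Finset.sum_insert ha]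
    calc _ ≤ ∑ ε : ι → ℤˣ, (‖signSum v s ε‖ ^ 4 + 6 * ‖v a‖ ^ 2 * ‖signSum v s ε‖ ^ 2
          + ‖v a‖ ^ 4) := by
          refine Finset.sum_le_sum fun ε _ => ?_
          have hu : ‖((ε a : ℤ) : ℝ) • v a‖ = ‖v a‖ := by
            rw [norm_smul, Real.norm_eq_abs, abs_sign, one_mul]
          have hcs := abs_real_inner_le_norm (signSum v s ε) (((ε a : ℤ) : ℝ) • v a)
          have hadd := norm_add_sq_real (signSum v s ε) (((ε a : ℤ) : ℝ) • v a)
          have hsub := norm_sub_sq_real (signSum v s ε) (((ε a : ℤ) : ℝ) • v a)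
          rw [hu] at hcs hadd hsub
          have hcs2 := pow_le_pow_left₀ (abs_nonneg _) hcs 2
          rw [sq_abs] at hcs2
          rw [show ∀ x : H, ‖x‖ ^ 4 = (‖x‖ ^ 2) ^ 2 from fun x => by ring,
            show ∀ x : H, ‖x‖ ^ 4 = (‖x‖ ^ 2) ^ 2 from fun x => by ring, hadd, hsub]
          nlinarith
      _ = ∑ ε : ι → ℤˣ, ‖signSum v s ε‖ ^ 4
          + 6 * ‖v a‖ ^ 2 * (Fintype.card (ι → ℤˣ) * ∑ i ∈ s, ‖v i‖ ^ 2)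
          + Fintype.card (ι → ℤˣ) * ‖v a‖ ^ 4 := by
          rw [← h2, Finset.sum_add_distrib, Finset.sum_add_distrib, ← Finset.mul_sum]
          simp
      _ ≤ _ := by
          have hK : (0 : ℝ) ≤ Fintype.card (ι → ℤˣ) := by positivity
          have : 0 ≤ Fintype.card (ι → ℤˣ) * ‖v a‖ ^ 4 := by positivity
          nlinarith

/-- Khintchine's inequality between the first and the second moment, for vectors of a Hilbert
space: the first moment is controlled from below by the second and the fourth. -/
lemma sqrt_sum_sq_le_sum_signSum (v : ι → H) :
    Fintype.card (ι → ℤˣ) * √(∑ i, ‖v i‖ ^ 2)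
      ≤ ∑ ε : ι → ℤˣ, 2 * ‖signSum v Finset.univ ε‖ := by
  have hs : 0 ≤ ∑ i, ‖v i‖ ^ 2 := by positivity
  set σ := √(∑ i, ‖v i‖ ^ 2) with hσ
  have hσ0 : 0 ≤ σ := Real.sqrt_nonneg _
  have hσ2 : ∑ i, ‖v i‖ ^ 2 = σ ^ 2 := (Real.sq_sqrt hs).symm
  rcases hσ0.eq_or_lt with h0 | hpos
  · rw [← h0, mul_zero]
    positivity
  have h2 := sum_norm_signSum_sq v Finset.univ
  have h4 := sum_norm_signSum_pow_four v Finset.univ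
  rw [hσ2] at h2 h4
  -- `x⁴ - 12 σ² x² + 16 σ³ x = x (x - 2 σ)² (x + 4 σ)`
  have hpt : ∀ ε : ι → ℤˣ, 12 * σ ^ 2 * ‖signSum v Finset.univ ε‖ ^ 2
      - ‖signSum v Finset.univ ε‖ ^ 4 ≤ 8 * σ ^ 3 * (2 * ‖signSum v Finset.univ ε‖) := by
    intro ε
    have hx := norm_nonneg (signSum v Finset.univ ε)
    have : 0 ≤ ‖signSum v Finset.univ ε‖ * (‖signSum v Finset.univ ε‖ - 2 * σ) ^ 2
        * (‖signSum v Finset.univ ε‖ + 4 * σ) := by positivity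
    nlinarith
  have hsum := Finset.sum_le_sum fun ε (_ : ε ∈ Finset.univ) => hpt ε
  rw [Finset.sum_sub_distrib, ← Finset.mul_sum, ← Finset.mul_sum, h2] at hsum
  have hK : (0 : ℝ) ≤ Fintype.card (ι → ℤˣ) := by positivity
  have h5 : σ ^ 3 * (8 * (Fintype.card (ι → ℤˣ) * σ)) ≤
      σ ^ 3 * (8 * ∑ ε : ι → ℤˣ, 2 * ‖signSum v Finset.univ ε‖) := by
    have : 0 ≤ (Fintype.card (ι → ℤˣ) : ℝ) * σ ^ 4 := by positivity
    nlinarith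
  have h6 := le_of_mul_le_mul_left h5 (by positivity)
  linarith

/-- One choice of signs works for a whole family of vector-valued sums, on average over the
family. -/
lemma exists_sign_sum_sqrt_le {κ : Type*} [Fintype κ] (v : κ → ι → H) :
    ∃ ε : ι → ℤˣ, ∑ n, √(∑ i, ‖v n i‖ ^ 2) ≤ 2 * ∑ n, ‖signSum (v n) Finset.univ ε‖ := by
  obtain ⟨ε, -, h⟩ := Finset.exists_le_of_sum_le (s := (Finset.univ : Finset (ι → ℤˣ)))
    (f := fun _ => ∑ n, √(∑ i, ‖v n i‖ ^ 2))
    (g := fun ε => 2 * ∑ n, ‖signSum (v n) Finset.univ ε‖) Finset.univ_nonempty (by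
      rw [Finset.sum_const, nsmul_eq_mul, Finset.card_univ, Finset.mul_sum]
      simp only [Finset.mul_sum]
      rw [Finset.sum_comm]
      exact Finset.sum_le_sum fun n _ => sqrt_sum_sq_le_sum_signSum (v n))
  exact ⟨ε, h⟩

/-- The mixed `(ℓ_1, ℓ_2)` inequality of Littlewood and Blei, in the form: some choice of unimodular
coefficients in all but one of the variables recovers the mixed norm of a tensor up to a
constant. -/
lemma exists_mixed_norm_le {κ : Type*} [Fintype κ] (d : ℕ) (a : (Fin d → ι) → κ → ℂ) :
    ∃ x : Fin d → ι → ℂ, (∀ k i, ‖x k i‖ ≤ 1) ∧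
      ∑ n, √(∑ j, ‖a j n‖ ^ 2) ≤ 2 ^ d * ∑ n, ‖∑ j, (∏ k, x k (j k)) * a j n‖ := by
  induction d with
  | zero =>
    refine ⟨fun k => k.elim0, fun k => k.elim0, ?_⟩
    simp [Real.sqrt_sq]
  | succ d ih =>
    -- The first variable is treated by Khintchine's inequality in `ℓ_2` of the remaining ones.
    let v : κ → ι → PiLp 2 (fun _ : Fin d → ι => ℂ) :=
      fun n i => WithLp.toLp 2 fun j => a (Fin.cons i j) n
    obtain ⟨ε, hε⟩ := exists_sign_sum_sqrt_le v
    obtain ⟨x, hx, hxs⟩ := ih fun j n => ∑ i, ((ε i : ℤ) : ℂ) * a (Fin.cons i j) n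
    refine ⟨Fin.cons (fun i => ((ε i : ℤ) : ℂ)) x, fun k => ?_, ?_⟩
    · refine Fin.cases (fun i => ?_) (fun k i => ?_) k
      · rcases Int.units_eq_one_or (ε i) with h | h <;> simp [h]
      · simpa using hx k i
    · have hv : ∀ n i, ‖v n i‖ ^ 2 = ∑ j, ‖a (Fin.cons i j) n‖ ^ 2 := fun n i =>
        EuclideanSpace.norm_sq_eq (v n i)
      have hS : ∀ n, ‖signSum (v n) Finset.univ ε‖
          = √(∑ j, ‖∑ i, ((ε i : ℤ) : ℂ) * a (Fin.cons i j) n‖ ^ 2) := by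
        intro n
        rw [EuclideanSpace.norm_eq]
        simp [signSum, v]
      calc ∑ n, √(∑ j, ‖a j n‖ ^ 2) = ∑ n, √(∑ i, ‖v n i‖ ^ 2) := by
            simp only [hv]
            refine Finset.sum_congr rfl fun n _ => ?_
            rw [sum_tuple_eq_sum_insertNth 0]
            simp
        _ ≤ 2 * (2 ^ d * ∑ n, ‖∑ j, (∏ k, x k (j k)) *
              ∑ i, ((ε i : ℤ) : ℂ) * a (Fin.cons i j) n‖) := by
            simp only [hS] at hε
            linarith
        _ = _ := by
            rw [← mul_assoc, pow_succ']
            congr 1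
            refine Finset.sum_congr rfl fun n _ => ?_
            congr 1
            rw [sum_tuple_eq_sum_insertNth 0, Finset.sum_comm]
            refine Finset.sum_congr rfl fun j _ => ?_
            rw [Finset.mul_sum]
            refine Finset.sum_congr rfl fun i _ => ?_
            simp [Fin.prod_univ_succ]
            ring

end Khintchine

/-! ### Weights in a weak space -/

section WeakWeights

/-- The inequality behind `∑_{k ≤ n} k^{1/m - 1} ≤ m n^{1/m}`. -/
lemma rpow_step_le {m : ℝ} (hm : 1 ≤ m) {n : ℝ} (hn : 0 ≤ n) :
    m * n ^ (1 / m) + (n + 1) ^ (1 / m - 1) ≤ m * (n + 1) ^ (1 / m) := by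
  have hn1 : 0 < n + 1 := by linarith
  have hm0 : 0 < m := by linarith
  have hb := rpow_one_add_le_one_add_mul_self (s := -(1 / (n + 1))) (p := 1 / m)
    (by rw [neg_le_neg_iff, div_le_one hn1]; linarith) (by positivity)
    (by rw [div_le_one hm0]; exact hm)
  have h1 : 1 + -(1 / (n + 1)) = n / (n + 1) := by field_simp; ring
  rw [h1, Real.div_rpow hn hn1.le, div_le_iff₀ (by positivity)] at hb
  rw [Real.rpow_sub_one hn1.ne']
  have h2 := mul_le_mul_of_nonneg_left hb hm0.le
  calc _ ≤ m * ((1 + 1 / m * -(1 / (n + 1))) * (n + 1) ^ (1 / m))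
        + (n + 1) ^ (1 / m) / (n + 1) := by gcongr
    _ = _ := by field_simp; ring

variable {ι : Type*} [DecidableEq ι] {d : ℕ} {w : ι → ℝ} {D : ℝ}

/-- If the `k`-th largest value of `w` is `O(k^{-1/p})` with `p = 2 (d + 1) / d`, then the sum of the
squares over `S` is `O(|S|^{1 - 2/p})`, by removing the smallest value from `S` repeatedly. -/
lemma sum_sq_le_of_weak (hd : 0 < d) (hw : ∀ i, 0 ≤ w i)
    (h : ∀ (S : Finset ι) (s : ℝ), 0 ≤ s → (∀ i ∈ S, s ≤ w i) →
      (S.card : ℝ) ^ ((d : ℝ) / (2 * (d + 1))) * s ≤ D) (S : Finset ι) :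
    ∑ i ∈ S, w i ^ 2 ≤ (d + 1) * D ^ 2 * (S.card : ℝ) ^ (1 / ((d : ℝ) + 1)) := by
  have hd' : (0 : ℝ) < d := by exact_mod_cast hd
  obtain ⟨n, hn⟩ : ∃ n, S.card = n := ⟨_, rfl⟩
  induction n generalizing S with
  | zero =>
    rw [Finset.card_eq_zero.1 hn]
    simp
    positivity
  | succ n ih =>
    have hne : S.Nonempty := Finset.card_pos.1 (by lia)
    obtain ⟨i₀, hi₀, hmin⟩ := S.exists_min_image w hne
    have h1 := h S (w i₀) (hw _) hmin
    have h2 := ih (S.erase i₀) (by rw [Finset.card_erase_of_mem hi₀, hn]; rfl)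
    rw [Finset.card_erase_of_mem hi₀, hn, Nat.add_sub_cancel] at h2
    rw [hn] at h1
    have hn1 : (0 : ℝ) < (n : ℝ) + 1 := by positivity
    push_cast at h1
    have h3 : w i₀ ^ 2 ≤ D ^ 2 * ((n : ℝ) + 1) ^ (1 / ((d : ℝ) + 1) - 1) := by
      have h4 := pow_le_pow_left₀ (mul_nonneg (by positivity) (hw _)) h1 2
      rw [mul_pow, ← Real.rpow_mul_natCast hn1.le] at h4
      have h5 : 1 / ((d : ℝ) + 1) - 1 = -((d : ℝ) / (2 * (d + 1)) * (2 : ℕ)) := by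
        push_cast; field_simp; ring
      rw [h5, Real.rpow_neg hn1.le, ← div_eq_mul_inv, le_div_iff₀ (by positivity), mul_comm]
      exact h4
    rw [← Finset.sum_erase_add _ _ hi₀, hn]
    have h6 := rpow_step_le (m := (d : ℝ) + 1) (by linarith) (Nat.cast_nonneg n)
    have h7 := mul_le_mul_of_nonneg_left h6 (sq_nonneg D)
    push_cast
    nlinarith

/-- On the set where a weight of `ℓ_{2m/(m-1),∞}` is at least `t`, the `ℓ_2` norms of `m - 1` copies
multiply up to `O(1/t)`. -/
lemma mul_sqrt_sum_sq_pow_le_of_weak (hd : 0 < d) (hw : ∀ i, 0 ≤ w i)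
    (h : ∀ (S : Finset ι) (s : ℝ), 0 ≤ s → (∀ i ∈ S, s ≤ w i) →
      (S.card : ℝ) ^ ((d : ℝ) / (2 * (d + 1))) * s ≤ D) {S : Finset ι} {t : ℝ} (ht : 0 ≤ t)
    (hS : ∀ i ∈ S, t ≤ w i) :
    t * √((∑ i ∈ S, w i ^ 2) ^ d) ≤ √(((d + 1) * D ^ 2) ^ d) * D := by
  have hd' : (0 : ℝ) < d := by exact_mod_cast hd
  have h1 := sum_sq_le_of_weak hd hw h S
  have h2 := h S t ht hS
  have hc : (0 : ℝ) ≤ S.card := by positivity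
  calc t * √((∑ i ∈ S, w i ^ 2) ^ d)
      ≤ t * √(((d + 1) * D ^ 2 * (S.card : ℝ) ^ (1 / ((d : ℝ) + 1))) ^ d) := by gcongr
    _ = √(((d + 1) * D ^ 2) ^ d) * ((S.card : ℝ) ^ ((d : ℝ) / (2 * (d + 1))) * t) := by
        rw [mul_pow, Real.sqrt_mul (by positivity), Real.sqrt_eq_rpow (_ ^ d),
          Real.sqrt_eq_rpow (_ ^ d), ← Real.rpow_mul_natCast hc, ← Real.rpow_mul hc,
          show 1 / ((d : ℝ) + 1) * d * (1 / 2) = (d : ℝ) / (2 * (d + 1)) by field_simp]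
        ring
    _ ≤ _ := by gcongr

/-- The tuples whose smallest weight sits at position `k` contribute at most the mixed norm of `a`:
by Cauchy–Schwarz in the other variables. -/
lemma sum_slot_le [Fintype ι] (hd : 0 < d) (hw : ∀ i, 0 ≤ w i)
    (h : ∀ (S : Finset ι) (s : ℝ), 0 ≤ s → (∀ i ∈ S, s ≤ w i) →
      (S.card : ℝ) ^ ((d : ℝ) / (2 * (d + 1))) * s ≤ D) (a : (Fin d → ι) → ι → ℝ) :
    ∑ n, ∑ j ∈ Fintype.piFinset fun _ : Fin d => {i | w n ≤ w i}, a j n * (w n * ∏ l, w (j l))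
      ≤ (√(((d + 1) * D ^ 2) ^ d) * D) * ∑ n, √(∑ j, a j n ^ 2) := by
  rw [Finset.mul_sum]
  refine Finset.sum_le_sum fun n _ => ?_
  set S : Finset ι := {i | w n ≤ w i} with hS
  have h1 := mul_sqrt_sum_sq_pow_le_of_weak hd hw h (S := S) (hw n) (by simp [hS])
  calc ∑ j ∈ Fintype.piFinset fun _ : Fin d => S, a j n * (w n * ∏ l, w (j l))
      = w n * ∑ j ∈ Fintype.piFinset fun _ : Fin d => S, a j n * ∏ l, w (j l) := by
        rw [Finset.mul_sum]
        exact Finset.sum_congr rfl fun j _ => by ring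
    _ ≤ w n * (√(∑ j ∈ Fintype.piFinset fun _ : Fin d => S, a j n ^ 2) *
          √(∑ j ∈ Fintype.piFinset fun _ : Fin d => S, (∏ l, w (j l)) ^ 2)) := by
        gcongr
        · exact hw n
        · exact Real.sum_mul_le_sqrt_mul_sqrt _ _ _
    _ ≤ w n * (√(∑ j, a j n ^ 2) * √((∑ i ∈ S, w i ^ 2) ^ d)) := by
        have := hw n
        gcongr
        · exact Finset.subset_univ _
        · simp only [← Finset.prod_pow]
          rw [← Finset.prod_univ_sum (fun _ : Fin d => S) fun _ i => w i ^ 2]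
          simp
    _ = (w n * √((∑ i ∈ S, w i ^ 2) ^ d)) * √(∑ j, a j n ^ 2) := by ring
    _ ≤ _ := by gcongr

end WeakWeights

/-! ### Convergence at products -/

section Products

variable {r : ℝ≥0∞} [Fact (1 ≤ r)]

/-- Absolute convergence at points `w y` with `w ∈ ℓ_{2m/(m-1),∞}` and `y ∈ ℓ_r`. -/
lemma summable_of_mul (hr : r ≠ ∞) {d : ℕ} (hd : 0 < d) {w : ℕ → ℝ} (hw : ∀ i, 0 ≤ w i) {D : ℝ}
    (h : ∀ (S : Finset ℕ) (s : ℝ), 0 ≤ s → (∀ i ∈ S, s ≤ w i) →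
      (S.card : ℝ) ^ ((d : ℝ) / (2 * (d + 1))) * s ≤ D) {y : ℕ → ℂ}
    (hy : Summable fun n => ‖y n‖ ^ r.toReal)
    (L : ContinuousMultilinearMap ℂ (fun _ : Fin (d + 1) => Ell r) ℂ) :
    Summable fun i : Fin (d + 1) → ℕ =>
      ‖L fun k => lp.single r (i k) (1 : ℂ)‖ * ∏ k, (w (i k) * ‖y (i k)‖) := by
  classical
  have hr0 := toReal_pos_of_one_le hr
  set Y : ℝ := (∑' n, ‖y n‖ ^ r.toReal) ^ (1 / r.toReal) with hY
  have hY0 : 0 ≤ Y := Real.rpow_nonneg (tsum_nonneg fun n => by positivity) _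
  have hYs : ∀ s : Finset ℕ, (∑ n ∈ s, ‖y n‖ ^ r.toReal) ^ (1 / r.toReal) ≤ Y := fun s => by
    rw [hY]
    gcongr
    exact hy.sum_le_tsum _ fun _ _ => by positivity
  have hD : 0 ≤ D := by simpa using h ∅ 0 le_rfl (by simp)
  refine summable_of_sum_cube_le
    (fun i => mul_nonneg (norm_nonneg _) (Finset.prod_nonneg fun k _ =>
      mul_nonneg (hw _) (norm_nonneg _)))
    (C := ∑ _k : Fin (d + 1), (√(((d + 1) * D ^ 2) ^ d) * D) * (2 ^ d * (‖L‖ * Y ^ d * Y)))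
    fun N => ?_
  have hN : ∀ (S : Finset (Fin N)) (s : ℝ), 0 ≤ s → (∀ i ∈ S, s ≤ w i) →
      (S.card : ℝ) ^ ((d : ℝ) / (2 * (d + 1))) * s ≤ D := by
    intro S s hs hS
    have := h (S.map Fin.valEmbedding) s hs (by simpa using hS)
    rwa [Finset.card_map] at this
  -- The factor `y` is absorbed into the coefficients of the form.
  set c : (Fin (d + 1) → Fin N) → ℂ := fun i =>
    L (fun k => lp.single r (i k : ℕ) (1 : ℂ)) * ∏ k, y (i k) with hc
  have hmixed : ∀ k : Fin (d + 1),
      ∑ n, √(∑ j : Fin d → Fin N, ‖c (k.insertNth n j)‖ ^ 2) ≤ 2 ^ d * (‖L‖ * Y ^ d * Y) := by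
    intro k
    obtain ⟨x, hx, hxs⟩ := exists_mixed_norm_le d fun (j : Fin d → Fin N) (n : Fin N) =>
      c (k.insertNth n j)
    refine hxs.trans ?_
    gcongr
    set u : Fin d → Ell r := fun l => ∑ i : Fin N, lp.single r (i : ℕ) (x l i * y i) with hu
    have hun : ∀ l, ‖u l‖ ≤ Y := by
      intro l
      have h1 : u l = ∑ i ∈ Finset.range N, lp.single r i
          ((if hi : i < N then x l ⟨i, hi⟩ else 0) * y i) := by
        rw [hu, ← Fin.sum_univ_eq_sum_range (fun i => (lp.single r i
          ((if hi : i < N then x l ⟨i, hi⟩ else 0) * y i) : Ell r))]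
        simp
      rw [h1, norm_sum_single_eq hr]
      refine le_trans ?_ (hYs (Finset.range N))
      gcongr with i
      rw [norm_mul]
      refine mul_le_of_le_one_left (norm_nonneg _) ?_
      split_ifs
      · exact hx _ _
      · simp
    have hval : ∀ n : Fin N, ∑ j : Fin d → Fin N, (∏ l, x l (j l)) * c (k.insertNth n j)
        = y n * L (k.insertNth (lp.single r (n : ℕ) (1 : ℂ)) u) := by
      intro n
      have h2 := (L.toMultilinearMap.curryMid k (lp.single r (n : ℕ) (1 : ℂ))).map_sum
        fun l (i : Fin N) => (x l i * y i) • (lp.single r (i : ℕ) (1 : ℂ) : Ell r)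
      have h3 : (fun l => ∑ i : Fin N, (x l i * y i) • (lp.single r (i : ℕ) (1 : ℂ) : Ell r))
          = u := by
        ext1 l
        refine Finset.sum_congr rfl fun i _ => ?_
        rw [← lp.single_smul]; simp
      rw [h3] at h2
      simp only [MultilinearMap.map_smul_univ, MultilinearMap.curryMid_apply_apply,
        ContinuousMultilinearMap.coe_coe] at h2
      rw [h2, Finset.mul_sum]
      refine Finset.sum_congr rfl fun j _ => ?_
      rw [hc]
      simp only [lpSingle_insertNth]
      rw [Fin.prod_univ_succAbove _ k, Finset.prod_mul_distrib]
      simp only [Fin.insertNth_apply_same, Fin.insertNth_apply_succAbove, smul_eq_mul]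
      ring
    have hfin := sum_norm_single_mul_le hr (slotFunctional L k u) (by positivity)
      (norm_slotFunctional_le L k hun) (Finset.range N)
      (c := fun n => ‖y n‖) fun n => norm_nonneg _
    calc _ = ∑ n ∈ Finset.range N, ‖slotFunctional L k u (lp.single r n (1 : ℂ))‖ * ‖y n‖ := by
          rw [← Fin.sum_univ_eq_sum_range fun n => ‖slotFunctional L k u (lp.single r n (1 : ℂ))‖ * ‖y n‖]
          refine Finset.sum_congr rfl fun n _ => ?_
          rw [hval, norm_mul, mul_comm]
          rfl
      _ ≤ _ := hfin
      _ ≤ _ := by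
          gcongr
          exact hYs _
  calc ∑ i : Fin (d + 1) → Fin N,
        ‖L fun k => lp.single r (i k : ℕ) (1 : ℂ)‖ * ∏ k, (w (i k) * ‖y (i k)‖)
      = ∑ i : Fin (d + 1) → Fin N, ‖c i‖ * ∏ k, w (i k) := by
        refine Finset.sum_congr rfl fun i _ => ?_
        rw [hc, norm_mul, norm_prod, Finset.prod_mul_distrib]
        ring
    _ ≤ ∑ i : Fin (d + 1) → Fin N, ∑ k, if ∀ l, w (i k) ≤ w (i l) then
          ‖c i‖ * ∏ k, w (i k) else 0 := by
        refine Finset.sum_le_sum fun i _ => ?_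
        have hnn : 0 ≤ ‖c i‖ * ∏ k, w (i k) :=
          mul_nonneg (norm_nonneg _) (Finset.prod_nonneg fun _ _ => hw _)
        obtain ⟨k, hk⟩ := Finite.exists_min fun k => w (i k)
        refine le_trans (le_of_eq (if_pos hk).symm) (Finset.single_le_sum
          (f := fun k => if ∀ l, w (i k) ≤ w (i l) then ‖c i‖ * ∏ k, w (i k) else 0)
          (fun k _ => ?_) (Finset.mem_univ k))
        split_ifs
        · exact hnn
        · exact le_rfl
    _ ≤ _ := by
        rw [Finset.sum_comm]
        refine Finset.sum_le_sum fun k _ => ?_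
        rw [sum_tuple_eq_sum_insertNth k]
        calc _ = ∑ n : Fin N, ∑ j ∈ Fintype.piFinset fun _ : Fin d => {i : Fin N | w n ≤ w i},
              ‖c (k.insertNth n j)‖ * (w n * ∏ l, w (j l)) := by
              refine Finset.sum_congr rfl fun n _ => ?_
              rw [← Finset.sum_filter]
              refine Finset.sum_congr ?_ fun j _ => ?_
              · ext j
                simp [Fin.forall_iff_succAbove k]
              · rw [Fin.prod_univ_succAbove _ k]
                simp
          _ ≤ _ := sum_slot_le (w := fun n : Fin N => w n) hd (fun _ => hw _) hN
              fun j n => ‖c (k.insertNth n j)‖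
          _ ≤ _ := by
              gcongr
              exact hmixed k

end Products

/-! ### Nets in the unit ball -/

section Nets

/-- A `1/2`-net of the unit ball with at most `5 ^ dim` points. -/
lemma exists_half_net (E : Type*) [NormedAddCommGroup E] [NormedSpace ℝ E] [FiniteDimensional ℝ E] :
    ∃ T : Finset E, T.card ≤ 5 ^ Module.finrank ℝ E ∧ (∀ t ∈ T, ‖t‖ ≤ 1) ∧
      ∀ x : E, ‖x‖ ≤ 1 → ∃ t ∈ T, ‖x - t‖ ≤ 1 / 2 := by
  classical
  set P : Finset E → Prop := fun s =>
    (∀ c ∈ s, ‖c‖ ≤ 2) ∧ ∀ c ∈ s, ∀ d ∈ s, c ≠ d → 1 ≤ ‖c - d‖ with hP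
  set A : Set ℕ := {n | ∃ s, P s ∧ s.card = n} with hA
  have hAb : BddAbove A := ⟨5 ^ Module.finrank ℝ E, by
    rintro _ ⟨s, hs, rfl⟩
    exact Besicovitch.card_le_of_separated s hs.1 hs.2⟩
  have hAne : A.Nonempty := ⟨0, ∅, by simp [hP], rfl⟩
  obtain ⟨s, hs, hcard⟩ := Nat.sSup_mem hAne hAb
  refine ⟨s.image fun c => (1 / 2 : ℝ) • c, ?_, ?_, fun x hx => ?_⟩
  · exact Finset.card_image_le.trans (Besicovitch.card_le_of_separated s hs.1 hs.2)
  · intro t ht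
    obtain ⟨c, hc, rfl⟩ := Finset.mem_image.1 ht
    have := hs.1 c hc
    rw [norm_smul]
    norm_num
    linarith
  · -- Otherwise `2 x` could be added to the maximal separated set `s`.
    have key : ∃ c ∈ s, ‖(2 : ℝ) • x - c‖ ≤ 1 := by
      by_contra! hfar
      have hx2 : (2 : ℝ) • x ∉ s := fun h => by simpa using (hfar _ h).trans' zero_lt_one
      have hmem : (insert ((2 : ℝ) • x) s).card ∈ A := by
        refine ⟨_, ⟨fun c hc => ?_, fun c hc d hd hcd => ?_⟩, rfl⟩
        · rcases Finset.mem_insert.1 hc with rfl | hc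
          · rw [norm_smul]; norm_num; linarith
          · exact hs.1 c hc
        · rcases Finset.mem_insert.1 hc with rfl | hc <;> rcases Finset.mem_insert.1 hd with rfl | hd
          · exact absurd rfl hcd
          · exact (hfar d hd).le
          · rw [norm_sub_rev]; exact (hfar c hc).le
          · exact hs.2 c hc d hd hcd
      have := le_csSup hAb hmem
      rw [Finset.card_insert_of_notMem hx2, hcard] at this
      lia
    obtain ⟨c, hc, hxc⟩ := key
    refine ⟨(1 / 2 : ℝ) • c, Finset.mem_image_of_mem _ hc, ?_⟩
    have : x - (1 / 2 : ℝ) • c = (1 / 2 : ℝ) • ((2 : ℝ) • x - c) := by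
      rw [smul_sub, smul_smul]; norm_num
    rw [this, norm_smul]
    norm_num
    linarith

variable {E : Type*} [NormedAddCommGroup E] [NormedSpace ℂ E] [FiniteDimensional ℂ E]

lemma norm_le_two_mul_of_net {T : Finset E} (hT : ∀ x : E, ‖x‖ ≤ 1 → ∃ t ∈ T, ‖x - t‖ ≤ 1 / 2)
    (φ : E →ₗ[ℂ] ℂ) {M : ℝ} (hφ : ∀ t ∈ T, ‖φ t‖ ≤ M) {x : E} (hx : ‖x‖ ≤ 1) :
    ‖φ x‖ ≤ 2 * M := by
  set ψ : E →L[ℂ] ℂ := LinearMap.toContinuousLinearMap φ with hψ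
  have hψφ : ∀ y, ψ y = φ y := fun y => rfl
  have hM : 0 ≤ M := by
    obtain ⟨t, ht, -⟩ := hT 0 (by simp)
    exact (norm_nonneg _).trans (hφ t ht)
  have h1 : ‖ψ‖ ≤ M + ‖ψ‖ * (1 / 2) := by
    refine ContinuousLinearMap.opNorm_le_of_unit_norm (by positivity) fun y hy => ?_
    obtain ⟨t, ht, hyt⟩ := hT y hy.le
    have h2 : ψ y = φ t + ψ (y - t) := by rw [← hψφ, ← map_add]; simp
    rw [h2]
    refine (norm_add_le _ _).trans (add_le_add (hφ t ht) ((ψ.le_opNorm _).trans ?_))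
    gcongr
  have h3 : ‖ψ‖ ≤ 2 * M := by linarith
  exact (ψ.le_of_opNorm_le h3 x).trans (mul_le_of_le_one_right (by positivity) hx)

/-- A bound for a multilinear form on a `1/2`-net of the unit ball extends to the unit ball, one
variable at a time. -/
lemma norm_le_of_net {m : ℕ} {T : Finset E}
    (hT : ∀ x : E, ‖x‖ ≤ 1 → ∃ t ∈ T, ‖x - t‖ ≤ 1 / 2)
    (A : MultilinearMap ℂ (fun _ : Fin m => E) ℂ) {M : ℝ}
    (hA : ∀ t : Fin m → E, (∀ k, t k ∈ T) → ‖A t‖ ≤ M) {x : Fin m → E} (hx : ∀ k, ‖x k‖ ≤ 1) :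
    ‖A x‖ ≤ 2 ^ m * M := by
  have key : ∀ (s : Finset (Fin m)) (y : Fin m → E), (∀ k ∈ s, ‖y k‖ ≤ 1) → (∀ k ∉ s, y k ∈ T) →
      ‖A y‖ ≤ 2 ^ s.card * M := by
    intro s
    induction s using Finset.induction_on with
    | empty => intro y _ hy; simpa using hA y fun k => hy k (by simp)
    | insert a s ha ih =>
      intro y hy1 hy2
      have h := norm_le_two_mul_of_net hT (A.toLinearMap y a) (M := 2 ^ s.card * M)
        (fun t ht => ?_) (x := y a) (hy1 a (Finset.mem_insert_self _ _))
      · rw [MultilinearMap.toLinearMap_apply, Function.update_eq_self] at h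
        rw [Finset.card_insert_of_notMem ha, pow_succ', mul_assoc]
        exact h
      · rw [MultilinearMap.toLinearMap_apply]
        refine ih _ (fun k hk => ?_) fun k hk => ?_
        · have : k ≠ a := fun h => ha (h ▸ hk)
          rw [Function.update_of_ne this]
          exact hy1 k (Finset.mem_insert_of_mem hk)
        · by_cases hka : k = a
          · subst hka; simpa using ht
          · rw [Function.update_of_ne hka]
            exact hy2 k (by simp [hka, hk])
  simpa using key Finset.univ x (fun k _ => hx k) (by simp)

end Nets

/-! ### Random signs -/

section RandomSigns

variable {ι τ : Type*} [Fintype ι] [DecidableEq ι] [Fintype τ]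

/-- Signed sums are subgaussian. -/
lemma sum_exp_sign_le (b : ι → ℝ) :
    ∑ ε : ι → ℤˣ, Real.exp (∑ i, ((ε i : ℤ) : ℝ) * b i)
      ≤ Fintype.card (ι → ℤˣ) * Real.exp ((∑ i, b i ^ 2) / 2) := by
  have h1 : ∑ ε : ι → ℤˣ, Real.exp (∑ i, ((ε i : ℤ) : ℝ) * b i)
      = ∏ i, ∑ e : ℤˣ, Real.exp (((e : ℤ) : ℝ) * b i) := by
    rw [Finset.prod_univ_sum, Fintype.piFinset_univ]
    simp [Real.exp_sum]
  have h2 : ∀ i, ∑ e : ℤˣ, Real.exp (((e : ℤ) : ℝ) * b i) ≤ 2 * Real.exp (b i ^ 2 / 2) := by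
    intro i
    have := Real.cosh_le_exp_half_sq (b i)
    rw [Real.cosh_eq] at this
    rw [UnitsInt.univ, Finset.sum_pair (by decide)]
    simp only [Units.val_one, Units.val_neg, Int.cast_one, Int.cast_neg, one_mul, neg_mul]
    linarith
  rw [h1]
  refine (Finset.prod_le_prod (fun i _ => by positivity) fun i _ => h2 i).trans (le_of_eq ?_)
  rw [Finset.prod_mul_distrib, ← Real.exp_sum, ← Finset.sum_div]
  simp

/-- Finitely many signed sums with square-summable coefficients are simultaneously small for some
choice of signs. -/
lemma exists_sign_abs_le (b : τ → ι → ℝ) (hb : ∀ t, ∑ i, b t i ^ 2 ≤ 1) {l B : ℝ} (hl : 0 < l)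
    (hB : 2 * (Fintype.card τ : ℝ) ≤ Real.exp B) :
    ∃ ε : ι → ℤˣ, ∀ t, |∑ i, ((ε i : ℤ) : ℝ) * b t i| ≤ (B + l ^ 2 / 2) / l := by
  have hone : ∀ t (e : ℝ), e ^ 2 = l ^ 2 →
      ∑ ε : ι → ℤˣ, Real.exp (e * ∑ i, ((ε i : ℤ) : ℝ) * b t i)
        ≤ Fintype.card (ι → ℤˣ) * Real.exp (l ^ 2 / 2) := by
    intro t e he
    have h := sum_exp_sign_le fun i => e * b t i
    have h' : ∑ i, (e * b t i) ^ 2 ≤ l ^ 2 := by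
      simp only [mul_pow, he]
      rw [← Finset.mul_sum]
      exact mul_le_of_le_one_right (sq_nonneg l) (hb t)
    calc _ = ∑ ε : ι → ℤˣ, Real.exp (∑ i, ((ε i : ℤ) : ℝ) * (e * b t i)) := by
          refine Finset.sum_congr rfl fun ε _ => ?_
          rw [Finset.mul_sum]
          congr 1
          exact Finset.sum_congr rfl fun i _ => by ring
      _ ≤ _ := h
      _ ≤ _ := by gcongr
  obtain ⟨ε, -, hε⟩ := Finset.exists_le_of_sum_le (s := (Finset.univ : Finset (ι → ℤˣ)))
    -- The average of the sum of exponential moments bounds it for one choice of signs.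
    (f := fun ε => ∑ t, (Real.exp (l * ∑ i, ((ε i : ℤ) : ℝ) * b t i)
      + Real.exp (-l * ∑ i, ((ε i : ℤ) : ℝ) * b t i)))
    (g := fun _ => 2 * (Fintype.card τ : ℝ) * Real.exp (l ^ 2 / 2)) Finset.univ_nonempty (by
      rw [Finset.sum_comm, Finset.sum_const, nsmul_eq_mul, Finset.card_univ]
      calc _ ≤ ∑ _t : τ, 2 * (Fintype.card (ι → ℤˣ) * Real.exp (l ^ 2 / 2)) := by
            refine Finset.sum_le_sum fun t _ => ?_
            rw [Finset.sum_add_distrib]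
            have := hone t l rfl
            have := hone t (-l) (by ring)
            linarith
        _ = _ := by
            rw [Finset.sum_const, nsmul_eq_mul, Finset.card_univ]
            ring)
  refine ⟨ε, fun t => ?_⟩
  have h1 := (Finset.single_le_sum (f := fun t => Real.exp (l * ∑ i, ((ε i : ℤ) : ℝ) * b t i)
      + Real.exp (-l * ∑ i, ((ε i : ℤ) : ℝ) * b t i)) (fun t _ => by positivity)
      (Finset.mem_univ t)).trans hε
  have h2 : 2 * (Fintype.card τ : ℝ) * Real.exp (l ^ 2 / 2) ≤ Real.exp (B + l ^ 2 / 2) := by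
    rw [Real.exp_add]; gcongr
  have h3 := h1.trans h2
  rw [le_div_iff₀ hl, ← Real.exp_le_exp]
  refine le_trans ?_ h3
  rcases abs_cases (∑ i, ((ε i : ℤ) : ℝ) * b t i) with ⟨h, -⟩ | ⟨h, -⟩
  · rw [h, mul_comm]
    exact le_add_of_nonneg_right (Real.exp_pos _).le
  · rw [h, neg_mul_comm, mul_comm]
    exact le_add_of_nonneg_left (Real.exp_pos _).le

end RandomSigns

/-! ### Sign tensors of small norm -/

section SignForms

/-- The multilinear form `∑_i c_i x_1(i_1) ⋯ x_m(i_m)` on `ℂⁿ`. -/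
noncomputable def tensorForm {m n : ℕ} (c : (Fin m → Fin n) → ℂ) :
    MultilinearMap ℂ (fun _ : Fin m => Fin n → ℂ) ℂ :=
  ∑ i, c i • (MultilinearMap.mkPiAlgebra ℂ (Fin m) ℂ).compLinearMap fun k => LinearMap.proj (i k)

lemma tensorForm_apply {m n : ℕ} (c : (Fin m → Fin n) → ℂ) (x : Fin m → Fin n → ℂ) :
    tensorForm c x = ∑ i, c i * ∏ k, x k (i k) := by
  simp [tensorForm]

/-- There is a tensor of signs whose multilinear form has norm `O(√n)` on the Euclidean ball. -/
lemma exists_sign_tensorForm (m : ℕ) {n : ℕ} (hn : 0 < n) :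
    ∃ ε : (Fin m → Fin n) → ℤˣ, ∀ x : Fin m → Fin n → ℂ, (∀ k, ∑ j, ‖x k j‖ ^ 2 ≤ 1) →
      ‖tensorForm (fun i => ((ε i : ℤ) : ℂ)) x‖ ≤ 2 ^ m * (8 * m + 6) * √n := by
  obtain ⟨T, hTcard, hT1, hT⟩ := exists_half_net (EuclideanSpace ℂ (Fin n))
  have hfr : Module.finrank ℝ (EuclideanSpace ℂ (Fin n)) = 2 * n := by
    rw [finrank_real_of_complex]; simp
  rw [hfr] at hTcard
  have hn' : (1 : ℝ) ≤ n := by exact_mod_cast hn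
  let P : (Fin m → T) → (Fin m → Fin n) → ℂ := fun t i => ∏ k, (t k : EuclideanSpace ℂ (Fin n)) (i k)
  have hP : ∀ t, ∑ i, ‖P t i‖ ^ 2 ≤ 1 := by
    intro t
    have : ∑ i, ‖P t i‖ ^ 2 = ∏ k, ∑ j, ‖(t k : EuclideanSpace ℂ (Fin n)) j‖ ^ 2 := by
      rw [Finset.prod_univ_sum, Fintype.piFinset_univ]
      simp [P, norm_prod, Finset.prod_pow]
    rw [this]
    refine Finset.prod_le_one (fun k _ => by positivity) fun k _ => ?_
    rw [← EuclideanSpace.norm_sq_eq]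
    exact pow_le_one₀ (norm_nonneg _) (hT1 _ (t k).2)
  let b : (Fin m → T) × Bool → (Fin m → Fin n) → ℝ := fun p i =>
    if p.2 then (P p.1 i).re else (P p.1 i).im
  have hb : ∀ p, ∑ i, b p i ^ 2 ≤ 1 := by
    intro p
    refine (Finset.sum_le_sum fun i _ => ?_).trans (hP p.1)
    simp only [b]
    split_ifs
    · exact sq_le_sq' (by linarith [neg_abs_le (P p.1 i).re, Complex.abs_re_le_norm (P p.1 i)])
        (Complex.re_le_norm _)
    · exact sq_le_sq' (by linarith [neg_abs_le (P p.1 i).im, Complex.abs_im_le_norm (P p.1 i)])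
        (Complex.im_le_norm _)
  have hsq : 0 < √(n : ℝ) := Real.sqrt_pos.2 (by linarith)
  have he1 : (2 : ℝ) ≤ Real.exp 1 := by linarith [Real.add_one_le_exp 1]
  have he2 : (5 : ℝ) ≤ Real.exp 2 := by
    have h := Real.quadratic_le_exp_of_nonneg (show (0 : ℝ) ≤ 2 by norm_num)
    linarith
  have hB : 2 * (Fintype.card ((Fin m → T) × Bool) : ℝ) ≤ Real.exp (2 + 4 * m * n) := by
    have h1 : (Fintype.card ((Fin m → T) × Bool) : ℝ) = (T.card : ℝ) ^ m * 2 := by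
      simp
    have h2 : (T.card : ℝ) ≤ 5 ^ (2 * n) := by exact_mod_cast hTcard
    calc 2 * (Fintype.card ((Fin m → T) × Bool) : ℝ) = (T.card : ℝ) ^ m * 2 ^ 2 := by rw [h1]; ring
      _ ≤ ((Real.exp 2) ^ (2 * n)) ^ m * (Real.exp 1) ^ 2 := by
          gcongr
          exact h2.trans (by gcongr)
      _ = _ := by
          rw [← Real.exp_nat_mul, ← Real.exp_nat_mul, ← Real.exp_nat_mul, ← Real.exp_add]
          congr 1
          push_cast
          ring
  -- The number of test points is exponential in `n`, which makes `√n` the right parameter.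
  obtain ⟨ε, hε⟩ := exists_sign_abs_le b hb hsq hB
  refine ⟨ε, fun x hx => ?_⟩
  have hbound : (2 + 4 * m * n + √(n : ℝ) ^ 2 / 2) / √(n : ℝ) ≤ (4 * m + 3) * √n := by
    rw [div_le_iff₀ hsq, mul_assoc (4 * (m : ℝ) + 3), Real.mul_self_sqrt (by linarith), Real.sq_sqrt (by linarith)]
    nlinarith
  let A : MultilinearMap ℂ (fun _ : Fin m => EuclideanSpace ℂ (Fin n)) ℂ :=
    (tensorForm fun i => ((ε i : ℤ) : ℂ)).compLinearMap
      fun _ => (WithLp.linearEquiv 2 ℂ (Fin n → ℂ)).toLinearMap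
  have hA : ∀ t : Fin m → EuclideanSpace ℂ (Fin n), (∀ k, t k ∈ T) →
      ‖A t‖ ≤ (8 * m + 6) * √n := by
    intro t ht
    have hval : A t = ∑ i, ((ε i : ℤ) : ℂ) * P (fun k => ⟨t k, ht k⟩) i := by
      simp [A, P, tensorForm_apply]
    have h1 := hε (fun k => ⟨t k, ht k⟩, true)
    have h2 := hε (fun k => ⟨t k, ht k⟩, false)
    have hre : (A t).re = ∑ i, ((ε i : ℤ) : ℝ) * b (fun k => ⟨t k, ht k⟩, true) i := by
      rw [hval, Complex.re_sum]
      refine Finset.sum_congr rfl fun i _ => ?_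
      simp [b]
    have him : (A t).im = ∑ i, ((ε i : ℤ) : ℝ) * b (fun k => ⟨t k, ht k⟩, false) i := by
      rw [hval, Complex.im_sum]
      refine Finset.sum_congr rfl fun i _ => ?_
      simp [b]
    rw [← hre] at h1
    rw [← him] at h2
    have := Complex.norm_le_abs_re_add_abs_im (A t)
    linarith
  have h := norm_le_of_net hT A hA (x := fun k => WithLp.toLp 2 (x k)) fun k => by
    rw [← sq_le_one_iff₀ (norm_nonneg _), EuclideanSpace.norm_sq_eq]
    exact hx k
  rw [mul_assoc]
  exact h

end SignForms

/-! ### From the Euclidean ball to the ball of `ℓ_r` -/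

section Interpolation

/-- The analytic family `z ↦ sgn(x) |x|^{r (1 - z / 2)}`, whose value at `z = 2 - 2 / r` is `x`. -/
noncomputable def powerPath (r : ℝ) (x z : ℂ) : ℂ :=
  if x = 0 then 0 else x / ‖x‖ * Complex.exp (Real.log ‖x‖ * r * (1 - z / 2))

lemma norm_powerPath {r : ℝ} (hr : 0 < r) (x : ℂ) {z : ℂ} (hz : z.re < 2) :
    ‖powerPath r x z‖ = ‖x‖ ^ (r * (1 - z.re / 2)) := by
  by_cases hx : x = 0
  · have : r * (1 - z.re / 2) ≠ 0 := by
      have : 0 < 1 - z.re / 2 := by linarith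
      positivity
    simp [powerPath, hx, Real.zero_rpow this]
  · have hx' : 0 < ‖x‖ := norm_pos_iff.2 hx
    rw [powerPath, if_neg hx, norm_mul, Complex.norm_exp, Real.rpow_def_of_pos hx', norm_div,
      Complex.norm_real, norm_norm, div_self hx'.ne', one_mul]
    congr 1
    simp [mul_assoc]

lemma powerPath_self {r : ℝ} (hr : 0 < r) (x : ℂ) :
    powerPath r x ((2 - 2 / r : ℝ) : ℂ) = x := by
  by_cases hx : x = 0
  · simp [powerPath, hx]
  · have hx' : 0 < ‖x‖ := norm_pos_iff.2 hx
    have hr' : (r : ℂ) ≠ 0 := by exact_mod_cast hr.ne'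
    have h1 : (Real.log ‖x‖ : ℂ) * r * (1 - ((2 - 2 / r : ℝ) : ℂ) / 2) = (Real.log ‖x‖ : ℂ) := by
      push_cast
      field_simp
      ring
    rw [powerPath, if_neg hx, h1, ← Complex.ofReal_exp, Real.exp_log hx',
      div_mul_cancel₀ _ (by exact_mod_cast hx'.ne')]

lemma differentiable_powerPath (r : ℝ) (x : ℂ) : Differentiable ℂ (powerPath r x) := by
  by_cases hx : x = 0
  · have : powerPath r x = fun _ => 0 := by ext; simp [powerPath, hx]
    rw [this]
    exact differentiable_const _
  · have : powerPath r x = fun z =>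
        x / ‖x‖ * Complex.exp (Real.log ‖x‖ * r * (1 - z / 2)) := by
      ext; simp [powerPath, hx]
    rw [this]
    fun_prop

variable {m n : ℕ}

/-- Riesz–Thorin interpolation for a tensor with entries in the unit disc: between the trivial bound
on the `ℓ_1` ball and a bound on the `ℓ_2` ball. -/
lemma norm_tensorForm_le_rpow (c : (Fin m → Fin n) → ℂ) (hc : ∀ i, ‖c i‖ ≤ 1) {Q : ℝ}
    (hQ : ∀ x : Fin m → Fin n → ℂ, (∀ k, ∑ j, ‖x k j‖ ^ 2 ≤ 1) → ‖tensorForm c x‖ ≤ Q)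
    {r : ℝ} (hr1 : 1 ≤ r) (hr2 : r ≤ 2) {x : Fin m → Fin n → ℂ}
    (hx : ∀ k, ∑ j, ‖x k j‖ ^ r ≤ 1) :
    ‖tensorForm c x‖ ≤ Q ^ (2 - 2 / r) := by
  have hr0 : 0 < r := by linarith
  have hle1 : ∀ k j, ‖x k j‖ ≤ 1 := by
    intro k j
    have h := (Finset.single_le_sum (f := fun j => ‖x k j‖ ^ r) (fun j _ => by positivity)
      (Finset.mem_univ j)).trans (hx k)
    by_contra! hlt
    exact absurd h (not_le.2 (Real.one_lt_rpow hlt hr0))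
  set f : ℂ → ℂ := fun z => tensorForm c fun k j => powerPath r (x k j) z with hf
  have hfle : ∀ z, ‖f z‖ ≤ ∏ k, ∑ j, ‖powerPath r (x k j) z‖ := by
    intro z
    rw [hf, Finset.prod_univ_sum, Fintype.piFinset_univ]
    simp only [tensorForm_apply]
    refine (norm_sum_le _ _).trans (Finset.sum_le_sum fun i _ => ?_)
    rw [norm_mul, norm_prod]
    exact mul_le_of_le_one_left (by positivity) (hc i)
  have hdiff : Differentiable ℂ f := by
    simp only [hf, tensorForm_apply]
    have := fun k j => differentiable_powerPath r (x k j)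
    fun_prop
  have hθ0 : 0 ≤ 2 - 2 / r := by
    rw [sub_nonneg, div_le_iff₀ hr0]; linarith
  have hθ1 : 2 - 2 / r ≤ 1 := by
    have : 1 ≤ 2 / r := by rw [le_div_iff₀ hr0]; linarith
    linarith
  have h := Complex.HadamardThreeLines.norm_le_interp_of_mem_verticalClosedStrip₀₁' f
    (z := ((2 - 2 / r : ℝ) : ℂ)) (a := 1) (b := Q) ?_ hdiff.diffContOnCl ?_ ?_ ?_
  · rw [Complex.ofReal_re, Real.one_rpow, one_mul] at h
    simpa only [hf, powerPath_self hr0] using h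
  · exact ⟨by simpa using hθ0, by simpa using hθ1⟩
  · refine ⟨(n : ℝ) ^ m, ?_⟩
    rintro _ ⟨z, hz, rfl⟩
    refine (hfle z).trans ?_
    calc _ ≤ ∏ _k : Fin m, ∑ _j : Fin n, (1 : ℝ) := by
          gcongr with k _ j _
          have hz1 : z.re ≤ 1 := hz.2
          rw [norm_powerPath hr0 _ (by linarith)]
          refine Real.rpow_le_one (norm_nonneg _) (hle1 k j) ?_
          have : 0 ≤ 1 - z.re / 2 := by linarith
          positivity
      _ = _ := by simp
  · intro z hz
    have hz0 : z.re = 0 := hz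
    refine (hfle z).trans (Finset.prod_le_one (fun k _ => by positivity) fun k _ => ?_)
    refine le_trans (le_of_eq (Finset.sum_congr rfl fun j _ => ?_)) (hx k)
    rw [norm_powerPath hr0 _ (by rw [hz0]; norm_num), hz0]
    norm_num
  · intro z hz
    have hz1 : z.re = 1 := hz
    refine hQ _ fun k => le_trans (le_of_eq (Finset.sum_congr rfl fun j _ => ?_)) (hx k)
    rw [norm_powerPath hr0 _ (by rw [hz1]; norm_num), hz1, ← Real.rpow_mul_natCast (norm_nonneg _)]
    congr 1
    push_cast
    ring

/-- Passing from the `ℓ_2` ball to the `ℓ_r` ball, `r ≥ 2`, costs a factor `n^{1/2 - 1/r}` for each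
variable. -/
lemma norm_tensorForm_le_of_two_le (c : (Fin m → Fin n) → ℂ) (hn : 0 < n) {Q : ℝ}
    (hQ : ∀ x : Fin m → Fin n → ℂ, (∀ k, ∑ j, ‖x k j‖ ^ 2 ≤ 1) → ‖tensorForm c x‖ ≤ Q)
    {r : ℝ} (hr : 2 ≤ r) {x : Fin m → Fin n → ℂ} (hx : ∀ k, ∑ j, ‖x k j‖ ^ r ≤ 1) :
    ‖tensorForm c x‖ ≤ (n : ℝ) ^ (m * (1 / 2 - 1 / r)) * Q := by
  have hr0 : 0 < r := by linarith
  have hn' : (0 : ℝ) < n := by exact_mod_cast hn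
  set S : ℝ := (n : ℝ) ^ (1 / 2 - 1 / r) with hS
  have hSpos : 0 < S := by positivity
  have hS' : (S : ℂ) ≠ 0 := by exact_mod_cast hSpos.ne'
  have hx2 : ∀ k, ∑ j, ‖x k j‖ ^ 2 ≤ S ^ 2 := by
    intro k
    have h := Real.rpow_sum_le_const_mul_sum_rpow_of_nonneg Finset.univ (p := r / 2)
      (f := fun j => ‖x k j‖ ^ 2) (by linarith) fun j _ => by positivity
    have h1 : ∀ j, (‖x k j‖ ^ 2) ^ (r / 2) = ‖x k j‖ ^ r := by
      intro j
      rw [← Real.rpow_natCast_mul (norm_nonneg _)]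
      congr 1
      push_cast
      ring
    simp only [h1, Finset.card_univ, Fintype.card_fin] at h
    have h2 : (∑ j, ‖x k j‖ ^ 2) ^ (r / 2) ≤ (S ^ 2) ^ (r / 2) := by
      refine h.trans ((mul_le_of_le_one_right (by positivity) (hx k)).trans (le_of_eq ?_))
      rw [hS, ← Real.rpow_mul_natCast hn'.le, ← Real.rpow_mul hn'.le]
      congr 1
      push_cast
      field_simp
    exact (Real.rpow_le_rpow_iff (by positivity) (by positivity) (by positivity)).1 h2
  have hscale : x = fun k => (S : ℂ) • ((S : ℂ)⁻¹ • x k) := by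
    ext k j
    simp [hS']
  have h := hQ (fun k => (S : ℂ)⁻¹ • x k) fun k => by
    have : ∀ j, ‖((S : ℂ)⁻¹ • x k) j‖ ^ 2 = (S ^ 2)⁻¹ * ‖x k j‖ ^ 2 := by
      intro j
      simp [mul_pow, abs_of_pos hSpos]
    simp only [this]
    rw [← Finset.mul_sum, inv_mul_le_one₀ (by positivity)]
    exact hx2 k
  rw [hscale, MultilinearMap.map_smul_univ, norm_smul]
  have hpow : ‖∏ _k : Fin m, (S : ℂ)‖ = (n : ℝ) ^ (m * (1 / 2 - 1 / r)) := by
    rw [Finset.prod_const, norm_pow, Complex.norm_real, Real.norm_of_nonneg hSpos.le, hS,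
      mul_comm (m : ℝ), Real.rpow_mul_natCast hn'.le]
    simp
  rw [hpow]
  gcongr

end Interpolation

/-! ### Block forms and the decay of points of convergence -/

section BlockForms

variable {r : ℝ≥0∞} [Fact (1 ≤ r)] {m n : ℕ}

/-- The form `∑_i c_i x_1(φ(1, i_1)) ⋯ x_m(φ(m, i_m))` on `ℓ_r`, whose variables live on the disjoint
blocks of coordinates `φ(k, ·)`. -/
noncomputable def blockForm (r : ℝ≥0∞) [Fact (1 ≤ r)] (c : (Fin m → Fin n) → ℂ)
    (φ : Fin m × Fin n ↪ ℕ) : ContinuousMultilinearMap ℂ (fun _ : Fin m => Ell r) ℂ :=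
  ∑ i, c i • (ContinuousMultilinearMap.mkPiAlgebra ℂ (Fin m) ℂ).compContinuousLinearMap
    fun k => lp.evalCLM ℂ (fun _ : ℕ => ℂ) r (φ (k, i k))

lemma blockForm_apply (c : (Fin m → Fin n) → ℂ) (φ : Fin m × Fin n ↪ ℕ) (x : Fin m → Ell r) :
    blockForm r c φ x = tensorForm c fun k j => x k (φ (k, j)) := by
  simp only [blockForm, tensorForm_apply, sum_apply, smul_apply,
    ContinuousMultilinearMap.compContinuousLinearMap_apply,
    ContinuousMultilinearMap.mkPiAlgebra_apply, smul_eq_mul]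
  rfl

lemma opNorm_le_of_unit_ball {E : Type*} [NormedAddCommGroup E] [NormedSpace ℂ E]
    (L : ContinuousMultilinearMap ℂ (fun _ : Fin m => E) ℂ) {Q : ℝ} (hQ0 : 0 ≤ Q)
    (hQ : ∀ x : Fin m → E, (∀ k, ‖x k‖ ≤ 1) → ‖L x‖ ≤ Q) : ‖L‖ ≤ Q := by
  refine L.opNorm_le_bound hQ0 fun x => ?_
  by_cases h0 : ∃ k, x k = 0
  · obtain ⟨k, hk⟩ := h0
    rw [L.map_coord_zero k hk, norm_zero]
    positivity
  · push Not at h0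
    have hscale : x = fun k => (‖x k‖ : ℂ) • ((‖x k‖ : ℂ)⁻¹ • x k) := by
      ext1 k
      rw [smul_inv_smul₀]
      exact_mod_cast norm_ne_zero_iff.2 (h0 k)
    have h := hQ (fun k => (‖x k‖ : ℂ)⁻¹ • x k) fun k => by
      rw [norm_smul, norm_inv, Complex.norm_real, norm_norm,
        inv_mul_cancel₀ (norm_ne_zero_iff.2 (h0 k))]
    rw [hscale, L.map_smul_univ, norm_smul, norm_prod, ← hscale, mul_comm]
    simp only [Complex.norm_real, norm_norm]
    gcongr

lemma norm_blockForm_le (hr : r ≠ ∞) (c : (Fin m → Fin n) → ℂ) (φ : Fin m × Fin n ↪ ℕ) {Q : ℝ}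
    (hQ0 : 0 ≤ Q) (hQ : ∀ x : Fin m → Fin n → ℂ, (∀ k, ∑ j, ‖x k j‖ ^ r.toReal ≤ 1) →
      ‖tensorForm c x‖ ≤ Q) : ‖blockForm r c φ‖ ≤ Q := by
  have hr0 := toReal_pos_of_one_le hr
  refine opNorm_le_of_unit_ball _ hQ0 fun x hx => ?_
  rw [blockForm_apply]
  refine hQ _ fun k => ?_
  have hinj : Function.Injective fun j : Fin n => φ (k, j) := fun a b hab => by
    simpa using φ.injective hab
  have h := lp.sum_rpow_le_norm_rpow hr0 (x k) (Finset.univ.map ⟨_, hinj⟩)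
  rw [Finset.sum_map] at h
  exact h.trans (Real.rpow_le_one (norm_nonneg _) (hx k) hr0.le)

lemma injective_blockTuple (φ : Fin m × Fin n ↪ ℕ) (i : Fin m → Fin n) :
    Function.Injective fun k => φ (k, i k) := fun _ _ hab =>
  congrArg Prod.fst (φ.injective hab)

/-- Disjointness of the blocks prevents cancellation: each monomial of a block form has a single
tensor entry as its coefficient. -/
lemma monCoeff_blockForm (c : (Fin m → Fin n) → ℂ) (φ : Fin m × Fin n ↪ ℕ) (i : Fin m → Fin n) :
    monCoeff (fun x => blockForm r c φ fun _ => x) (tupleIndex fun k => φ (k, i k)) = c i := by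
  classical
  have hval : ∀ σ : Equiv.Perm (Fin m), ∀ k j,
      (lp.single r (φ (σ k, i (σ k))) (1 : ℂ) : Ell r) (φ (k, j))
        = if σ k = k ∧ j = i k then 1 else 0 := by
    intro σ k j
    rw [lp.single_apply, Pi.single_apply]
    refine if_congr ?_ rfl rfl
    rw [φ.injective.eq_iff, Prod.mk.injEq]
    constructor
    · rintro ⟨h1, h2⟩
      rw [← h1] at h2
      exact ⟨h1.symm, h2⟩
    · rintro ⟨h1, h2⟩
      rw [h1]
      exact ⟨rfl, h2⟩
  rw [monCoeff_tupleIndex _ (injective_blockTuple φ i), Finset.sum_eq_single 1]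
  · rw [blockForm_apply, tensorForm_apply, Finset.sum_eq_single i]
    · simp
    · intro i' _ hne
      obtain ⟨k, hk⟩ := Function.ne_iff.1 hne
      rw [Finset.prod_eq_zero (Finset.mem_univ k), mul_zero]
      simp [hk]
    · simp
  · intro σ _ hσ
    obtain ⟨k, hk⟩ : ∃ k, σ k ≠ k := by
      by_contra! h
      exact hσ (Equiv.ext h)
    rw [blockForm_apply]
    refine MultilinearMap.map_coord_zero _ k (funext fun j => ?_)
    rw [hval]
    simp [hk]
  · simp

lemma injective_tupleIndex_block (φ : Fin m × Fin n ↪ ℕ) :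
    Function.Injective fun i : Fin m → Fin n => tupleIndex fun k => φ (k, i k) := by
  intro i i' h
  have h1 := congrArg Finsupp.toMultiset h
  simp only [toMultiset_tupleIndex] at h1
  ext1 k
  have h2 : φ (k, i k) ∈ Finset.univ.val.map fun k => φ (k, i k) :=
    Multiset.mem_map_of_mem _ (Finset.mem_univ k)
  rw [h1] at h2
  obtain ⟨l, -, hl⟩ := Multiset.mem_map.1 h2
  have h3 := φ.injective hl
  rw [Prod.mk.injEq] at h3
  obtain ⟨rfl, h4⟩ := h3
  exact h4.symm

/-- Testing monomial convergence at `z` on a sign tensor placed on coordinates where `|z| ≥ s`. -/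
lemma exists_pow_le_of_mem_mon (hr : r ≠ ∞) {z : ℕ → ℂ} (hz : z ∈ mon (homPoly m r)) :
    ∃ C : ℝ, 0 ≤ C ∧ ∀ (n : ℕ) (ε : (Fin m → Fin n) → ℤˣ) (Q : ℝ), 0 ≤ Q →
      (∀ x : Fin m → Fin n → ℂ, (∀ k, ∑ j, ‖x k j‖ ^ r.toReal ≤ 1) →
        ‖tensorForm (fun i => ((ε i : ℤ) : ℂ)) x‖ ≤ Q) →
      ∀ (S : Finset ℕ) (s : ℝ), m * n ≤ S.card → 0 ≤ s → (∀ i ∈ S, s ≤ ‖z i‖) →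
        (n * s) ^ m ≤ C * Q := by
  classical
  obtain ⟨C, hC⟩ := exists_bound_of_mem_mon hz
  refine ⟨max C 0, le_max_right _ _, fun n ε Q hQ0 hQ S s hS hs hzS => ?_⟩
  obtain ⟨ψ⟩ : Nonempty (Fin m × Fin n ↪ S) :=
    Function.Embedding.nonempty_of_card_le (by simpa using hS)
  set φ : Fin m × Fin n ↪ ℕ := ψ.trans (Function.Embedding.subtype _) with hφ
  have hzφ : ∀ p, s ≤ ‖z (φ p)‖ := fun p => hzS _ (ψ p).2
  set c : (Fin m → Fin n) → ℂ := fun i => ((ε i : ℤ) : ℂ) with hc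
  have h := hC (blockForm r c φ) (Finset.univ.map ⟨_, injective_tupleIndex_block φ⟩)
  rw [Finset.sum_map] at h
  simp only [Function.Embedding.coeFn_mk, monCoeff_blockForm, prod_tupleIndex] at h
  have hc1 : ∀ i, ‖c i‖ = 1 := by
    intro i
    rcases Int.units_eq_one_or (ε i) with h | h <;> simp [hc, h]
  calc ((n : ℝ) * s) ^ m = ∑ _i : Fin m → Fin n, ∏ _k : Fin m, s := by
        simp [mul_pow]
    _ ≤ ∑ i, ‖c i * ∏ k, z (φ (k, i k))‖ := by
        refine Finset.sum_le_sum fun i _ => ?_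
        rw [norm_mul, hc1, one_mul, norm_prod]
        exact Finset.prod_le_prod (fun _ _ => hs) fun k _ => hzφ _
    _ ≤ C * ‖blockForm r c φ‖ := h
    _ ≤ max C 0 * Q := by
        gcongr
        · exact le_max_left _ _
        · exact norm_blockForm_le hr c φ hQ0 hQ

/-- If the sign tensors have norm `O(n^e)` on `ℓ_r`, then `mon P(^m ℓ_r)` is contained in
`ℓ_{p,∞}` with `1 / p = 1 - e / m`. -/
lemma mem_weakLp_of_mem_mon (hr : r ≠ ∞) (hm : 0 < m) {e K p : ℝ} (hp : 0 < p)
    (hpe : 1 / p = 1 - e / m) (hK : 0 ≤ K)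
    (hε : ∀ n : ℕ, 0 < n → ∃ ε : (Fin m → Fin n) → ℤˣ, ∀ x : Fin m → Fin n → ℂ,
      (∀ k, ∑ j, ‖x k j‖ ^ r.toReal ≤ 1) →
        ‖tensorForm (fun i => ((ε i : ℤ) : ℂ)) x‖ ≤ K * (n : ℝ) ^ e)
    {z : ℕ → ℂ} (hz : z ∈ mon (homPoly m r)) : z ∈ weakLp p := by
  have hr0 := toReal_pos_of_one_le hr
  have hm' : (0 : ℝ) < m := by exact_mod_cast hm
  have hp' : 0 < 1 / p := by positivity
  obtain ⟨C, hC0, hC⟩ := exists_pow_le_of_mem_mon hr hz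
  obtain ⟨R, hR⟩ : ∃ R : ℝ, ∀ i, ‖z i‖ ≤ R := by
    have hb := (Memℓp.of_exponent_ge hz.1 le_top).bddAbove
    obtain ⟨R, hR⟩ := hb
    exact ⟨R, fun i => hR ⟨i, rfl⟩⟩
  have hR0 : 0 ≤ R := (norm_nonneg _).trans (hR 0)
  rw [mem_weakLp_iff hp]
  refine ⟨max ((m : ℝ) ^ (1 / p) * R) ((2 * m : ℝ) ^ (1 / p) * (C * K) ^ (1 / (m : ℝ))),
    fun S s hs hS => ?_⟩
  rcases Nat.lt_or_ge S.card m with hlt | hge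
  · refine le_trans ?_ (le_max_left _ _)
    rcases S.eq_empty_or_nonempty with rfl | ⟨i, hi⟩
    · simp only [Finset.card_empty, Nat.cast_zero, Real.zero_rpow hp'.ne', zero_mul]
      positivity
    · gcongr
      exact (hS i hi).trans (hR i)
  · refine le_trans ?_ (le_max_right _ _)
    -- `S` has room for `m` disjoint blocks of this size.
    set n : ℕ := S.card / m with hn
    have hn0 : 0 < n := Nat.div_pos hge hm
    have hn' : (0 : ℝ) < n := by exact_mod_cast hn0
    have hle : m * n ≤ S.card := Nat.mul_div_le _ _
    have hge2 : (S.card : ℝ) ≤ 2 * m * n := by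
      have h1 : S.card < m * (n + 1) := by
        rw [mul_comm]; exact Nat.lt_mul_of_div_lt (Nat.lt_succ_self _) hm
      have h2 : m * (n + 1) ≤ 2 * m * n := by nlinarith
      exact_mod_cast h1.le.trans h2
    obtain ⟨ε, hε⟩ := hε n hn0
    have h := hC n ε _ (by positivity) hε S s hle hs hS
    have h1 : ((n : ℝ) ^ (1 / p) * s) ^ m ≤ C * K := by
      have h2 : ((n : ℝ) ^ (1 / p) * s) ^ m * (n : ℝ) ^ e = (n * s) ^ m := by
        have h4 : (1 - e / m) * m + e = m := by field_simp; ring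
        rw [mul_pow, mul_pow, ← Real.rpow_mul_natCast hn'.le, hpe, mul_right_comm,
          ← Real.rpow_add hn', h4, Real.rpow_natCast]
      rw [← h2, ← mul_assoc] at h
      exact le_of_mul_le_mul_right h (by positivity)
    have h3 : (n : ℝ) ^ (1 / p) * s ≤ (C * K) ^ (1 / (m : ℝ)) := by
      rw [one_div (m : ℝ), Real.le_rpow_inv_iff_of_pos (by positivity) (by positivity) hm',
        Real.rpow_natCast]
      exact h1
    calc (S.card : ℝ) ^ (1 / p) * s ≤ (2 * m * n : ℝ) ^ (1 / p) * s := by gcongr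
      _ = (2 * m : ℝ) ^ (1 / p) * ((n : ℝ) ^ (1 / p) * s) := by
          rw [Real.mul_rpow (by positivity) hn'.le, mul_assoc]
      _ ≤ _ := by gcongr

end BlockForms

/-! ### The inclusions -/

section Inclusions

variable {r : ℝ≥0∞} [Fact (1 ≤ r)]

lemma mul_weakLp_subset_mon (hr : r ≠ ∞) {d : ℕ} (hd : 0 < d) :
    weakLp (2 * ((d + 1 : ℕ) : ℝ) / (((d + 1 : ℕ) : ℝ) - 1)) * seqLp r
      ⊆ mon (homPoly (d + 1) r) := by
  rintro _ ⟨w, hw, y, hy, rfl⟩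
  have hr0 := toReal_pos_of_one_le hr
  have hd' : (0 : ℝ) < d := by exact_mod_cast hd
  have hexp : 1 / (2 * ((d + 1 : ℕ) : ℝ) / (((d + 1 : ℕ) : ℝ) - 1)) = (d : ℝ) / (2 * (d + 1)) := by
    push_cast
    rw [add_sub_cancel_right, one_div_div]
  have hpos : 0 < 2 * ((d + 1 : ℕ) : ℝ) / (((d + 1 : ℕ) : ℝ) - 1) := by
    push_cast
    rw [add_sub_cancel_right]
    positivity
  rw [mem_weakLp_iff hpos, hexp] at hw
  obtain ⟨D, hD⟩ := hw
  have hys : Summable fun n => ‖y n‖ ^ r.toReal := Memℓp.summable hr0 hy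
  have hwD : ∀ i, ‖w i‖ ≤ D := fun i => by
    simpa using hD {i} ‖w i‖ (norm_nonneg _) (by simp)
  have hD0 : 0 ≤ D := (norm_nonneg _).trans (hwD 0)
  refine mem_mon_of_summable (memℓp_gen ?_) fun L => ?_
  · refine Summable.of_nonneg_of_le (fun n => by positivity) (fun n => ?_)
      (hys.mul_left (D ^ r.toReal))
    simp only [Pi.mul_apply, norm_mul]
    rw [Real.mul_rpow (norm_nonneg _) (norm_nonneg _)]
    have := hwD n
    gcongr
  · have h := summable_of_mul hr hd (fun i => norm_nonneg (w i)) hD hys L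
    simpa only [Pi.mul_apply, norm_mul] using h

lemma mon_subset_weakLp_of_two_le (hr : r ≠ ∞) (hr2 : 2 ≤ r) {m : ℕ} (hm : 0 < m) :
    mon (homPoly m r) ⊆ weakLp (1 / r.toReal + ((m : ℝ) - 1) / (2 * (m : ℝ)))⁻¹ := by
  intro z hz
  have hr0 := toReal_pos_of_one_le hr
  have hr2' : 2 ≤ r.toReal := by
    simpa using ENNReal.toReal_mono hr hr2
  have hm' : (1 : ℝ) ≤ m := by exact_mod_cast hm
  have hm0 : (0 : ℝ) < m := by linarith
  have hpos : 0 < 1 / r.toReal + ((m : ℝ) - 1) / (2 * (m : ℝ)) := by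
    have : 0 ≤ ((m : ℝ) - 1) / (2 * (m : ℝ)) := div_nonneg (by linarith) (by linarith)
    positivity
  refine mem_weakLp_of_mem_mon hr hm (e := m * (1 / 2 - 1 / r.toReal) + 1 / 2)
    (K := 2 ^ m * (8 * m + 6)) (by positivity) ?_ (by positivity) (fun n hn => ?_) hz
  · rw [one_div, inv_inv]
    field_simp
    ring
  · obtain ⟨ε, hε⟩ := exists_sign_tensorForm m hn
    refine ⟨ε, fun x hx => (norm_tensorForm_le_of_two_le _ hn hε hr2' hx).trans (le_of_eq ?_)⟩
    have hn' : (0 : ℝ) < n := by exact_mod_cast hn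
    rw [Real.rpow_add hn', Real.sqrt_eq_rpow]
    ring

lemma conjExponent_mul_conjExponent {s : ℝ} (hs : 1 < s) (d : ℕ) :
    Real.conjExponent (((d + 1 : ℕ) : ℝ) * Real.conjExponent s)
      = (d + 1) * s / (d * s + 1) := by
  have h1 : s - 1 ≠ 0 := by linarith
  have h2 : (d : ℝ) * s + 1 ≠ 0 := by positivity
  have h3 : ((d : ℝ) + 1) * (s / (s - 1)) - 1 = (d * s + 1) / (s - 1) := by
    field_simp
    ring
  rw [Real.conjExponent, Real.conjExponent]
  push_cast
  rw [h3]
  field_simp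

lemma seqLp_subset_mon (hr : r ≠ ∞) (hr1 : 1 < r) (d : ℕ) {p : ℝ}
    (hp : p ≤ Real.conjExponent (((d + 1 : ℕ) : ℝ) * Real.conjExponent r.toReal)) :
    seqLp (ENNReal.ofReal p) ⊆ mon (homPoly (d + 1) r) := by
  intro z hz
  have hs : 1 < r.toReal := by
    simpa using (ENNReal.toReal_lt_toReal (by simp) hr).2 hr1
  rw [conjExponent_mul_conjExponent hs] at hp
  set s := r.toReal with hsdef
  set q : ℝ := (d + 1) * s / (d * s + 1) with hq
  have hden : 0 < (d : ℝ) * s + 1 := by positivity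
  have hd0 : (0 : ℝ) ≤ d := by positivity
  have hq1 : 1 ≤ q := by
    rw [hq, le_div_iff₀ hden]
    linarith
  have hqs : q ≤ s := by
    rw [hq, div_le_iff₀ hden]
    nlinarith [mul_nonneg hd0 (sub_nonneg.2 hs.le)]
  have hzq : Memℓp z (ENNReal.ofReal q) := hz.of_exponent_ge (ENNReal.ofReal_le_ofReal hp)
  have hzr : Memℓp z r := by
    refine hzq.of_exponent_ge ?_
    rw [ENNReal.ofReal_le_iff_le_toReal hr]
    exact hqs
  have hsum : Summable fun n => ‖z n‖ ^ q := by
    have h := Memℓp.summable (p := ENNReal.ofReal q)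
      (by rw [ENNReal.toReal_ofReal (by linarith)]; linarith) hzq
    rwa [ENNReal.toReal_ofReal (by linarith)] at h
  refine mem_mon_of_summable hzr fun L => summable_of_memℓp hr hq1 ?_ hsum L
  rw [hq, ← hsdef]
  field_simp
  ring

lemma mon_subset_weakLp_of_le_two (hr1 : 1 < r) (hr2 : r ≤ 2) (d : ℕ) :
    mon (homPoly (d + 1) r)
      ⊆ weakLp (Real.conjExponent (((d + 1 : ℕ) : ℝ) * Real.conjExponent r.toReal)) := by
  intro z hz
  have hr : r ≠ ∞ := ne_top_of_le_ne_top (by simp) hr2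
  have hs : 1 < r.toReal := by
    simpa using (ENNReal.toReal_lt_toReal (by simp) hr).2 hr1
  have hs2 : r.toReal ≤ 2 := by
    simpa using ENNReal.toReal_mono (by simp) hr2
  have hden : 0 < (d : ℝ) * r.toReal + 1 := by positivity
  rw [conjExponent_mul_conjExponent hs]
  set C : ℝ := 2 ^ (d + 1) * (8 * ((d + 1 : ℕ) : ℝ) + 6) with hC
  have hC0 : 0 ≤ C := by positivity
  refine mem_weakLp_of_mem_mon hr d.succ_pos (e := 1 - 1 / r.toReal)
    (K := C ^ (2 - 2 / r.toReal)) (by positivity) ?_ (by positivity) (fun n hn => ?_) hz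
  · push_cast
    field_simp
    ring
  · obtain ⟨ε, hε⟩ := exists_sign_tensorForm (d + 1) hn
    have hε1 : ∀ i, ‖((ε i : ℤ) : ℂ)‖ ≤ 1 := by
      intro i
      rcases Int.units_eq_one_or (ε i) with h | h <;> simp [h]
    refine ⟨ε, fun x hx => (norm_tensorForm_le_rpow _ hε1 hε hs.le hs2 hx).trans (le_of_eq ?_)⟩
    rw [Real.mul_rpow hC0 (Real.sqrt_nonneg _), Real.sqrt_eq_rpow,
      ← Real.rpow_mul (Nat.cast_nonneg n)]
    congr 2
    ring

end Inclusions

end MonConv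

theorem theorem5p1 (m : ℕ) (hm : 2 ≤ m) (r : ℝ≥0∞) [Fact (1 ≤ r)] :
    (2 ≤ r → r < ∞ →
      MonConv.weakLp (2 * (m : ℝ) / ((m : ℝ) - 1)) * MonConv.seqLp r
          ⊆ MonConv.mon (MonConv.homPoly m r) ∧
      MonConv.mon (MonConv.homPoly m r)
          ⊆ MonConv.weakLp (1 / r.toReal + ((m : ℝ) - 1) / (2 * (m : ℝ)))⁻¹) ∧
    (1 < r → r < 2 →
      (∀ ε : ℝ, 0 < ε → ε < Real.conjExponent ((m : ℝ) * Real.conjExponent r.toReal) →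
        MonConv.seqLp
            (ENNReal.ofReal (Real.conjExponent ((m : ℝ) * Real.conjExponent r.toReal) - ε))
          ⊆ MonConv.mon (MonConv.homPoly m r)) ∧
      MonConv.mon (MonConv.homPoly m r)
          ⊆ MonConv.weakLp (Real.conjExponent ((m : ℝ) * Real.conjExponent r.toReal))) := by
  obtain ⟨d, rfl⟩ : ∃ d, m = d + 1 := ⟨m - 1, by lia⟩
  refine ⟨fun h2 hfin => ⟨MonConv.mul_weakLp_subset_mon hfin.ne (by lia),
    MonConv.mon_subset_weakLp_of_two_le hfin.ne h2 (by lia)⟩, fun h1 h2 => ⟨fun ε hε _ => ?_,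
    MonConv.mon_subset_weakLp_of_le_two h1 h2.le d⟩⟩
  exact MonConv.seqLp_subset_mon (ne_top_of_lt h2) h1 d (by linarith)
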